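/- Let $n\ge 4$, let $V=\{1,\dots,n\}$, let $E$ be an index set with $|E|=n-3$, and let $\mathcal T=(e)_{e\in E}$ be a family of 4-tuples $e=(v_{e,1},v_{e,2},v_{e,3},v_{e,4})$ of distinct elements of $V$ (for instance the hyperedges of a 4-uniform hypergraph on $V$, each listed in some order). Let $M_{0,n}$ be the complex variety of $n$-tuples of distinct points of $\mathbb P^1=\mathbb P^1_{\mathbb C}$ up to Möbius transformations, and let $$\mathrm{CR}_{\mathcal T}:M_{0,n}\to(\mathbb C\setminus\{0,1\})^{E},\qquad (z_1,\dots,z_n)\mapsto\left(\frac{(z_{v_{e,3}}-z_{v_{e,1}})(z_{v_{e,4}}-z_{v_{e,2}})}{(z_{v_{e,3}}-z_{v_{e,2}})(z_{v_{e,4}}-z_{v_{e,1}})}\right)_{e\in E}.$$ Let $d_{\mathcal T}$ be the degree of $\mathrm{CR}_{\mathcal T}$, that is, the degree of the extension of function fields if $\mathrm{CR}_{\mathcal T}$ is dominant, and $0$ otherwise. For $v\in V$ let $E_v=\{e\in E: v\in e\}$, and for $P_v\in(\mathbb P^1)^{E_v}$ let $Y_v=\pi_{E_v}^{-1}(P_v)\subseteq(\mathbb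 P^1)^E$, where $\pi_{E_v}:(\mathbb P^1)^E\to(\mathbb P^1)^{E_v}$ is the projection. Let $\mathcal M$ be the moduli space of smooth connected curves $C\subseteq(\mathbb P^1)^E$ of multidegree $(1,\dots,1)$ (each projection $C\to\mathbb P^1$ has degree $1$), and let $Z_v=\{C\in\mathcal M: C\cap Y_v\neq\emptyset\}$. Then for general $(P_v)_{v\in V}$, i.e. for all $(P_v)_{v\in V}$ in some nonempty Zariski-open subset of $\prod_{v\in V}(\mathbb P^1)^{E_v}$, there are exactly $d_{\mathcal T}$ curves $C\in\mathcal M$ such that $C$ intersects $Y_v$ for all $v\in V$. Equivalently, the intersection $\bigcap_{v\in V}Z_v$ consists of exactly $d_{\mathcal T}$ points. -/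

import Mathlib

namespace CrossRatio

open MvPolynomial

noncomputable section

/-! ### The cross-ratio degree -/

/-- The determinant `p₀ q₁ - p₁ q₀` of two vectors of homogeneous coordinates. In the affine
coordinate `z = p₀ / p₁` it is `z(p) - z(q)`, up to the factor `p₁ q₁`. -/
def bracket {K : Type*} [Field K] (p q : Fin 2 → K) : K := p 0 * q 1 - p 1 * q 0

/-- The cross-ratio `((z₃ - z₁) (z₄ - z₂)) / ((z₃ - z₂) (z₄ - z₁))`, in homogeneous coordinates
(so that a point at infinity is allowed). -/
def crossRatio {K : Type*} [Field K] (p₁ p₂ p₃ p₄ : Fin 2 → K) : K :=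
  (bracket p₃ p₁ * bracket p₄ p₂) / (bracket p₃ p₂ * bracket p₄ p₁)

/-- The function field of `M_{0,n}`, for `n ≥ 3`. Moving the first three points to `∞, 0, 1` by the
unique Möbius transformation that does so identifies `M_{0,n}` with the open subvariety of affine
`(n-3)`-space of the tuples of distinct `t_v ≠ 0, 1`; the field is `ℂ(t_v : v ≥ 3)`
(the points are numbered from `0`). -/
abbrev M0FunctionField (n : ℕ) : Type :=
  FractionRing (MvPolynomial {v : Fin n // 3 ≤ v.val} ℂ)

/-- The generic point of `M_{0,n}`: the marked points `∞, 0, 1, t₃, t₄, …` in homogeneous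
coordinates over the function field. -/
def genericMarkedPoint (n : ℕ) (v : Fin n) : Fin 2 → M0FunctionField n :=
  if h : 3 ≤ v.val then
    ![algebraMap (MvPolynomial {v : Fin n // 3 ≤ v.val} ℂ) (M0FunctionField n) (X ⟨v, h⟩), 1]
  else if v.val = 0 then ![1, 0]
  else if v.val = 1 then ![0, 1]
  else ![1, 1]

/-- The components of the map `CR_𝒯 : M_{0,n} → (ℂ \ {0,1})^(n-3)`, as rational functions. -/
def crossRatioMap {n : ℕ} (T : Fin (n - 3) → (Fin 4 ↪ Fin n)) (e : Fin (n - 3)) :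
    M0FunctionField n :=
  crossRatio (genericMarkedPoint n (T e 0)) (genericMarkedPoint n (T e 1))
    (genericMarkedPoint n (T e 2)) (genericMarkedPoint n (T e 3))

open Classical in
/-- The degree of `CR_𝒯`: the degree of the extension of function fields if `CR_𝒯` is dominant,
that is, if its components are algebraically independent, and `0` otherwise. -/
def crossRatioDegree {n : ℕ} (T : Fin (n - 3) → (Fin 4 ↪ Fin n)) : ℕ :=
  if AlgebraicIndependent ℂ (crossRatioMap T) then
    Module.finrank (IntermediateField.adjoin ℂ (Set.range (crossRatioMap T))) (M0FunctionField n)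
  else 0

/-! ### The variety `(ℙ¹)^S` -/

/-- The complex projective line. -/
abbrev P1 : Type := Projectivization ℂ (Fin 2 → ℂ)

/-- `(ℙ¹)^S`. It carries the Zariski topology (see below), not the product topology. -/
def P1Pow (S : Type*) : Type _ := S → P1

/-- `F`, a polynomial in the variables `x_{s,0}, x_{s,1}` (`s ∈ S`), is multihomogeneous of
multidegree `d`: homogeneous of degree `d s` in `x_{s,0}, x_{s,1}`, for every `s`. -/
def IsMultihomogeneous {S : Type*} (F : MvPolynomial (S × Fin 2) ℂ) (d : S →₀ ℕ) : Prop :=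
  IsWeightedHomogeneous (fun i : S × Fin 2 => Finsupp.single i.1 1) F d

/-- Homogeneous coordinates of a point of `(ℙ¹)^S`. -/
def P1Pow.coords {S : Type*} (P : P1Pow S) (i : S × Fin 2) : ℂ := (P i.1).rep i.2

/-- The value of a polynomial at the chosen homogeneous coordinates of `P`. If `F` is
multihomogeneous then whether this value vanishes does not depend on the choice. -/
def P1Pow.evalAt {S : Type*} (P : P1Pow S) (F : MvPolynomial (S × Fin 2) ℂ) : ℂ :=
  eval P.coords F

/-- The Zariski topology of `(ℙ¹)^S`, generated by the sets on which a multihomogeneous polynomial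
does not vanish. -/
instance P1Pow.zariski (S : Type*) : TopologicalSpace (P1Pow S) :=
  TopologicalSpace.generateFrom
    {U | ∃ F d, IsMultihomogeneous F d ∧ U = {P : P1Pow S | P.evalAt F ≠ 0}}

/-- The multihomogeneous polynomials that vanish on `C`. -/
def vanishingForms {S : Type*} (C : Set (P1Pow S)) : Set (MvPolynomial (S × Fin 2) ℂ) :=
  {F | (∃ d, IsMultihomogeneous F d) ∧ ∀ P ∈ C, P.evalAt F = 0}

/-- The differential of `F` at (the chosen homogeneous coordinates of) `P`. -/
def differential {S : Type*} [Fintype S] (P : P1Pow S) (F : MvPolynomial (S × Fin 2) ℂ) :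
    (S × Fin 2 → ℂ) →ₗ[ℂ] ℂ :=
  ∑ i, P.evalAt (pderiv i F) • LinearMap.proj i

/-- The Zariski tangent space, at the chosen coordinates of `P`, of the multi-cone over `C` in
`(ℂ²)^S`. Its dimension exceeds that of the tangent space of `C` at `P` by `|S|`. -/
def coneTangentSpace {S : Type*} [Fintype S] (C : Set (P1Pow S)) (P : P1Pow S) :
    Submodule ℂ (S × Fin 2 → ℂ) :=
  ⨅ F ∈ vanishingForms C, LinearMap.ker (differential P F)

/-- `C` is a smooth connected (equivalently, smooth irreducible) closed curve in `(ℙ¹)^S`: it is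
Zariski closed, irreducible and of dimension `1`, and its tangent spaces have dimension `1`. -/
structure IsSmoothCurve {S : Type*} [Fintype S] (C : Set (P1Pow S)) : Prop where
  isClosed : IsClosed C
  isIrreducible : IsIrreducible C
  dim_eq_one : topologicalKrullDim C = 1
  smooth : ∀ P ∈ C, Module.finrank ℂ (coneTangentSpace C P) = Fintype.card S + 1

/-- The projection `π_s : C → ℙ¹` of an irreducible closed `C` has degree `1`: it is dominant, and
it identifies the function field of `ℙ¹` with that of `C`, i.e. every rational function `F / G` on
`C` (with `F, G` of the same multidegree and `G` not identically zero on `C`) is the pullback of a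
rational function `a / b` on `ℙ¹`. -/
def ProjectionHasDegreeOne {S : Type*} (C : Set (P1Pow S)) (s : S) : Prop :=
  ((fun P : P1Pow S => P s) '' C).Infinite ∧
  ∀ (F G : MvPolynomial (S × Fin 2) ℂ) (d : S →₀ ℕ),
    IsMultihomogeneous F d → IsMultihomogeneous G d → (∃ P ∈ C, P.evalAt G ≠ 0) →
    ∃ (a b : MvPolynomial (Fin 2) ℂ) (k : ℕ), a.IsHomogeneous k ∧ b.IsHomogeneous k ∧ b ≠ 0 ∧
      ∀ P ∈ C, P.evalAt F * eval (P s).rep b = P.evalAt G * eval (P s).rep a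

/-- The (closed points of the) moduli space of smooth connected curves in `(ℙ¹)^S` of multidegree
`(1, …, 1)`. The `s`-th entry of the multidegree of a curve is the degree of its projection to the
`s`-th factor. -/
def curveModuli (S : Type*) [Fintype S] : Set (Set (P1Pow S)) :=
  {C | IsSmoothCurve C ∧ ∀ s, ProjectionHasDegreeOne C s}

/-- The linear subvariety `Y(S', P) = π_{S'}⁻¹(P)` of type `S'`. -/
def linearSubvariety {S : Type*} (S' : Set S) (P : P1Pow S') : Set (P1Pow S) :=
  {x | (fun s : S' => x s) = P}

/-- The incidence subvariety `Z(S', P)` of the moduli space. -/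
def incidenceSubvariety {S : Type*} [Fintype S] (S' : Set S) (P : P1Pow S') :
    Set (Set (P1Pow S)) :=
  {C ∈ curveModuli S | (C ∩ linearSubvariety S' P).Nonempty}

/-! ### Hypergraphs -/

/-- `E_v`, the set of the hyperedges that contain `v`. -/
def edgesAt {n : ℕ} (T : Fin (n - 3) → (Fin 4 ↪ Fin n)) (v : Fin n) : Set (Fin (n - 3)) :=
  {e | v ∈ Set.range (T e)}

/-- The incidence set `I` of the pairs `(v, e)` with `v ∈ e`, so that `(ℙ¹)^I` is the product of
the `(ℙ¹)^{E_v}`. -/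
abbrev Incidence {n : ℕ} (T : Fin (n - 3) → (Fin 4 ↪ Fin n)) : Type :=
  Σ v : Fin n, edgesAt T v

/-- The component `P_v ∈ (ℙ¹)^{E_v}` of a point of `(ℙ¹)^I`. -/
def component {n : ℕ} {T : Fin (n - 3) → (Fin 4 ↪ Fin n)} (P : P1Pow (Incidence T)) (v : Fin n) :
    P1Pow (edgesAt T v) :=
  fun e => P ⟨v, e⟩

end

end CrossRatio

namespace CrossRatio
noncomputable section

/-! ### The cardinality of a generic fibre -/

/-! A curve of multidegree (1,…,1) is the image of ℙ¹ under u ↦ (A_e u)_e for Möbius transformations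
A_e, unique up to a common change of the parameter u. Indeed, projections of degree one make any two
coordinates rational functions of each other, hence linear fractional (`exists_eq_moebiusCurve`);
conversely all these images are smooth curves of the required kind (`moebiusCurve_mem_curveModuli`).

Such a curve meets Y_v exactly when some parameter u_v satisfies A_e u_v = P_{v,e} for all e
containing v. For one hyperedge e with distinct points u_v, and distinct points P_{v,e}, a
transformation A_e with this property exists if and only if both quadruples have the same
cross-ratio, and it is then unique. So the curves through all Y_v correspond to the configurations
(u_v) modulo Möbius transformations whose cross-ratios are those prescribed by P, that is, to a
fibre of CR over a point c(P) (`encard_curves_eq_encard_configurations`). The points P_{v,e}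
belonging to different hyperedges are independent, so c(P) is as general as needed.

Two nonzero polynomials in c describe what general means. The first makes the fibre have d points
(`exists_encard_fibre_eq`): in the dominant case the function field is generated over ℂ(f) by an
element θ integral over ℂ[f], and the fibre over c is in bijection with the simple roots of the
specialised minimal polynomial of θ; otherwise a relation between the components empties the general
fibre. The second forces the u_v to be distinct and every vertex to lie on a hyperedge
(`exists_nondegeneracy_condition`): otherwise the n - 3 cross-ratios would depend on fewer than n
points, thus on fewer than n - 3 parameters modulo Möbius transformations, and would satisfy a
relation. -/

open IntermediateField in
theorem exists_isIntegral_adjoin_eq_top (A k K : Type*) [CommRing A] [IsDomain A] [Field k]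
    [Algebra A k] [IsFractionRing A k] [Field K] [Algebra k K] [Algebra A K] [IsScalarTower A k K]
    [FiniteDimensional k K] [Algebra.IsSeparable k K] :
    ∃ θ : K, IsIntegral A θ ∧ k⟮θ⟯ = ⊤ := by
  obtain ⟨θ, hθ⟩ := Field.exists_primitive_element k K
  have halg : IsAlgebraic A θ :=
    (IsFractionRing.isAlgebraic_iff A k K).mpr (Algebra.IsAlgebraic.isAlgebraic θ)
  -- The factor `y` that makes the primitive element integral is a unit of `k`, so the field
  -- generated does not change.
  obtain ⟨y, hy, hθint⟩ := halg.exists_integral_multiple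
  refine ⟨y • θ, hθint, ?_⟩
  have hy' : algebraMap A k y ≠ 0 := by simpa using hy
  rw [eq_top_iff, ← hθ, adjoin_simple_le_iff]
  have h1 : y • θ ∈ k⟮y • θ⟯ := mem_adjoin_simple_self k _
  have h2 : θ = (algebraMap A k y)⁻¹ • (y • θ) := by
    rw [← IsScalarTower.algebraMap_smul k y θ, smul_smul, inv_mul_cancel₀ hy', one_smul]
  have h3 := IntermediateField.smul_mem _ h1 (x := (algebraMap A k y)⁻¹)
  rwa [← h2] at h3

-- Since θ is algebraic, k(θ) = k[θ], and the coefficients have a common denominator `g` in `A`.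
-- Where `g` does not vanish, the value of κ is determined by that of θ.
open IntermediateField Polynomial in
theorem exists_mul_eq_aeval {A k K : Type*} [CommRing A] [IsDomain A] [Field k]
    [Algebra A k] [IsFractionRing A k] [Field K] [Algebra k K] [Algebra A K] [IsScalarTower A k K]
    [FiniteDimensional k K] {θ : K} (hθ : k⟮θ⟯ = ⊤) (κ : K) :
    ∃ g : A, g ≠ 0 ∧ ∃ W : A[X], algebraMap A K g * κ = aeval θ W := by
  have h1 : κ ∈ Algebra.adjoin k {θ} := by
    have : κ ∈ k⟮θ⟯ := hθ ▸ mem_top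
    rwa [← adjoin_simple_toSubalgebra_of_isAlgebraic (Algebra.IsAlgebraic.isAlgebraic θ),
      mem_toSubalgebra]
  rw [Algebra.adjoin_singleton_eq_range_aeval] at h1
  obtain ⟨w, rfl⟩ := h1
  obtain ⟨b, hb0, hb⟩ := IsLocalization.integerNormalization_spec (nonZeroDivisors A) w
  refine ⟨b, nonZeroDivisors.ne_zero hb0,
    IsLocalization.integerNormalization (nonZeroDivisors A) w, ?_⟩
  have := congrArg (aeval θ) hb
  rw [aeval_map_algebraMap] at this
  rw [this, ← IsScalarTower.algebraMap_smul k, map_smul, Algebra.smul_def,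
    ← IsScalarTower.algebraMap_apply]
  rfl

-- Separability makes μ'(θ) invertible for the minimal polynomial μ, and `g` is a denominator of its
-- inverse. Where `g` does not vanish, the specialised polynomial has no root in common with its
-- derivative, so it has as many roots as its degree.
open IntermediateField Polynomial in
theorem exists_encard_roots_minpoly {A k K : Type*} [CommRing A] [IsDomain A] [IsIntegrallyClosed A]
    [Field k] [Algebra A k] [IsFractionRing A k] [Field K] [Algebra k K] [Algebra A K]
    [IsScalarTower A k K] [FiniteDimensional k K] [Algebra.IsSeparable k K] {θ : K}
    (hθint : IsIntegral A θ) (hθ : k⟮θ⟯ = ⊤) (L : Type*) [Field L] [IsAlgClosed L] :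
    ∃ g : A, g ≠ 0 ∧ ∀ ev : A →+* L, ev g ≠ 0 →
      {x : L | eval₂ ev x (minpoly A θ) = 0}.encard = Module.finrank k K := by
  classical
  have hfs : FaithfulSMul A K := by
    rw [faithfulSMul_iff_algebraMap_injective, IsScalarTower.algebraMap_eq A k K]
    exact (algebraMap k K).injective.comp (IsFractionRing.injective A k)
  have hmin : minpoly k θ = (minpoly A θ).map (algebraMap A k) :=
    minpoly.isIntegrallyClosed_eq_field_fractions' k hθint
  have hne : aeval θ (derivative (minpoly A θ)) ≠ 0 := by
    have h := (Algebra.IsSeparable.isSeparable k θ).aeval_derivative_ne_zero (minpoly.aeval k θ)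
    rwa [hmin, derivative_map, aeval_map_algebraMap] at h
  obtain ⟨g, hg, W, hW⟩ := exists_mul_eq_aeval (A := A) hθ
    (aeval θ (derivative (minpoly A θ)))⁻¹
  refine ⟨g, hg, fun ev hev => ?_⟩
  -- Since `A` is integrally closed, the divisibility holds over `A` itself and therefore survives
  -- specialization.
  have hdvd : minpoly A θ ∣ W * derivative (minpoly A θ) - C g := by
    apply minpoly.isIntegrallyClosed_dvd hθint
    rw [map_sub, map_mul, ← hW, aeval_C, mul_assoc, inv_mul_cancel₀ hne, mul_one, sub_self]
  have hmonic := minpoly.monic hθint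
  set μ := (minpoly A θ).map ev with hμ
  have hμm : μ.Monic := hmonic.map ev
  have hroot : ∀ x, μ.eval x = 0 → (derivative μ).eval x ≠ 0 := by
    intro x hx h0
    obtain ⟨Q, hQ⟩ := hdvd
    have := congrArg (fun p => (p.map ev).eval x) hQ
    simp only [Polynomial.map_sub, Polynomial.map_mul, ← derivative_map, ← hμ, eval_sub,
      Polynomial.eval_mul, hx, h0, map_C, Polynomial.eval_C] at this
    simp at this
    exact hev this
  have hnd : μ.roots.Nodup := by
    rw [Multiset.nodup_iff_count_le_one]
    intro x
    rw [count_roots]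
    by_contra! hlt
    have := (one_lt_rootMultiplicity_iff_isRoot hμm.ne_zero).mp hlt
    exact hroot x this.1 this.2
  have hset : {x : L | eval₂ ev x (minpoly A θ) = 0} = (μ.roots.toFinset : Set L) := by
    ext x
    simp [hμ, Polynomial.eval_map, (hmonic.map ev).ne_zero]
  rw [hset, Set.encard_coe_eq_coe_finsetCard, Multiset.toFinset_card_of_nodup hnd,
    ← (IsAlgClosed.splits μ).natDegree_eq_card_roots, hmonic.natDegree_map,
    ← hmonic.natDegree_map (algebraMap A k), ← hmin,
    ← adjoin.finrank (Algebra.IsIntegral.isIntegral θ), hθ, finrank_top']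

/-- A ring homomorphism to a field extends to the local ring of its kernel, inside any field that
contains the ring. -/
theorem exists_extension_to_localRing {F A K L : Type*} [Field F] [CommRing A] [Field K] [Field L]
    [Algebra F A] [Algebra F K] [Algebra F L] [Algebra A K] [IsScalarTower F A K]
    (hinj : Function.Injective (algebraMap A K)) (χ : A →ₐ[F] L) :
    ∃ (O : Subalgebra F K) (ψ : O →ₐ[F] L), ∀ (a s : A) (x : K), χ s ≠ 0 →
      x * algebraMap A K s = algebraMap A K a → ∃ hx : x ∈ O, ψ ⟨x, hx⟩ * χ s = χ a := by
  have hp : (RingHom.ker χ).IsPrime := RingHom.ker_isPrime _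
  let B := Localization.AtPrime (RingHom.ker χ)
  -- Elements outside the kernel are invertible in both `K` and `L`, so the local ring maps to both;
  -- its map to `K` is injective, and `O` is the image.
  have hu : ∀ y : (RingHom.ker χ).primeCompl, IsUnit (algebraMap A K y) := by
    rintro ⟨y, hy⟩
    rw [isUnit_iff_ne_zero, Ne, map_eq_zero_iff _ hinj]
    rintro rfl
    exact hy (Ideal.zero_mem _)
  have hu' : ∀ y : (RingHom.ker χ).primeCompl, IsUnit (χ y) := by
    rintro ⟨y, hy⟩
    rw [isUnit_iff_ne_zero]
    exact hy
  let i : B →ₐ[F] K := IsLocalization.liftAlgHom (M := (RingHom.ker χ).primeCompl)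
    (f := IsScalarTower.toAlgHom F A K) hu
  let j : B →ₐ[F] L := IsLocalization.liftAlgHom (M := (RingHom.ker χ).primeCompl) (f := χ) hu'
  have hi : ∀ a, i (algebraMap A B a) = algebraMap A K a := fun a =>
    IsLocalization.lift_eq hu a
  have hj : ∀ a, j (algebraMap A B a) = χ a := fun a =>
    IsLocalization.lift_eq hu' a
  have hiinj : Function.Injective i := by
    rw [injective_iff_map_eq_zero]
    intro b hb
    obtain ⟨⟨a, s⟩, has⟩ := IsLocalization.surj (RingHom.ker χ).primeCompl b
    have h1 : algebraMap A K a = 0 := by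
      have := congrArg i has
      rw [map_mul, hb, zero_mul, hi] at this
      exact this.symm
    have h2 : a = 0 := (map_eq_zero_iff _ hinj).mp h1
    simp only [h2, map_zero] at has
    exact (IsLocalization.map_units B s).mul_left_eq_zero.mp has
  let e : B ≃ₐ[F] i.range := AlgEquiv.ofInjective i hiinj
  refine ⟨i.range, j.comp e.symm.toAlgHom, fun a s x hs hx => ?_⟩
  have hsK : algebraMap A K s ≠ 0 := fun h => hs (by
    rw [(map_eq_zero_iff _ hinj).mp h, map_zero])
  let b : B := IsLocalization.mk' B a (⟨s, hs⟩ : (RingHom.ker χ).primeCompl)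
  have hb : b * algebraMap A B s = algebraMap A B a := IsLocalization.mk'_spec B a _
  have hib : i b = x := by
    have := congrArg i hb
    rw [map_mul, hi, hi, ← hx] at this
    exact mul_right_cancel₀ hsK this
  have hmem : x ∈ i.range := ⟨b, hib⟩
  refine ⟨hmem, ?_⟩
  have heb : e b = ⟨x, hmem⟩ := Subtype.ext hib
  have : e.symm ⟨x, hmem⟩ = b := by rw [← heb, e.symm_apply_apply]
  change j (e.symm ⟨x, hmem⟩) * _ = _
  rw [this, ← hj, ← map_mul, hb, hj]

open Polynomial in
theorem exists_apply_aeval_eq_eval₂ {F K L : Type*} [Field F] [Field K] [Field L]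
    [Algebra F K] [Algebra F L] {A O : Subalgebra F K} (ψ : O →ₐ[F] L) (hA : A ≤ O) {θ : K}
    (hθ : θ ∈ O) (W : A[X]) :
    ∃ h : aeval θ W ∈ O, ψ ⟨aeval θ W, h⟩ =
      eval₂ (ψ.comp (Subalgebra.inclusion hA) : A →+* L) (ψ ⟨θ, hθ⟩) W := by
  have h : aeval θ W = O.val (eval₂ (Subalgebra.inclusion hA : A →+* O) ⟨θ, hθ⟩ W) := by
    rw [aeval_def]
    exact (hom_eval₂ W (Subalgebra.inclusion hA : A →+* O) (O.val : O →+* K) ⟨θ, hθ⟩).symm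
  refine ⟨h ▸ SetLike.coe_mem _, ?_⟩
  have h2 : (⟨aeval θ W, h ▸ SetLike.coe_mem _⟩ : O) =
      eval₂ (Subalgebra.inclusion hA : A →+* O) ⟨θ, hθ⟩ W := Subtype.ext h
  rw [h2]
  exact hom_eval₂ W (Subalgebra.inclusion hA : A →+* O) (ψ : O →+* L) ⟨θ, hθ⟩

theorem aeval_complex_eq_eval {σ : Type*} (t : σ → ℂ) (p : MvPolynomial σ ℂ) :
    MvPolynomial.aeval t p = MvPolynomial.eval t p := by
  rw [← MvPolynomial.coe_aeval_eq_eval]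
  rfl

/-- A place of the field of rational functions that is centred at the point `t`. -/
theorem exists_place_of_point {σ : Type*} {K : Type*} [Field K] [Algebra ℂ K]
    [Algebra (MvPolynomial σ ℂ) K] [IsScalarTower ℂ (MvPolynomial σ ℂ) K]
    [IsFractionRing (MvPolynomial σ ℂ) K] (t : σ → ℂ) :
    ∃ (O : Subalgebra ℂ K) (ψ : O →ₐ[ℂ] ℂ), ∀ (a s : MvPolynomial σ ℂ), MvPolynomial.eval t s ≠ 0 →
      ∃ hx : algebraMap _ K a / algebraMap _ K s ∈ O,
        ψ ⟨_, hx⟩ = MvPolynomial.eval t a / MvPolynomial.eval t s := by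
  obtain ⟨O, ψ, h⟩ := exists_extension_to_localRing (F := ℂ) (A := MvPolynomial σ ℂ) (K := K)
    (IsFractionRing.injective _ _) (MvPolynomial.aeval t : MvPolynomial σ ℂ →ₐ[ℂ] ℂ)
  simp only [aeval_complex_eq_eval] at h
  refine ⟨O, ψ, fun a s hs => ?_⟩
  have hs0 : algebraMap _ K s ≠ 0 := by
    rw [Ne, map_eq_zero_iff _ (IsFractionRing.injective _ _)]
    rintro rfl
    exact hs (map_zero _)
  obtain ⟨hx, hx'⟩ := h a s (algebraMap _ K a / algebraMap _ K s) hs (div_mul_cancel₀ _ hs0)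
  exact ⟨hx, by rw [eq_div_iff hs]; exact hx'⟩

theorem aeval_apply_of_mem {F K L : Type*} [Field F] [Field K] [Field L] [Algebra F K] [Algebra F L]
    {ι : Type*} {O : Subalgebra F K} (ψ : O →ₐ[F] L) {f : ι → K} (hf : ∀ i, f i ∈ O)
    (R : MvPolynomial ι F) : ∃ h : MvPolynomial.aeval f R ∈ O,
      ψ ⟨_, h⟩ = MvPolynomial.aeval (fun i => ψ ⟨f i, hf i⟩) R := by
  have h : MvPolynomial.aeval f R = O.val (MvPolynomial.aeval (fun i => (⟨f i, hf i⟩ : O)) R) := by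
    exact MvPolynomial.comp_aeval_apply (fun i => (⟨f i, hf i⟩ : O)) O.val R |>.symm
  refine ⟨h ▸ SetLike.coe_mem _, ?_⟩
  have h2 : (⟨MvPolynomial.aeval f R, h ▸ SetLike.coe_mem _⟩ : O) =
      MvPolynomial.aeval (fun i => (⟨f i, hf i⟩ : O)) R := Subtype.ext h
  rw [h2, ← MvPolynomial.comp_aeval_apply]

/-- A polynomial relation between rational functions holds between their values. -/
theorem eval_eq_zero_of_aeval_div_eq_zero {σ ι : Type*} {K : Type*} [Field K] [Algebra ℂ K]
    [Algebra (MvPolynomial σ ℂ) K] [IsScalarTower ℂ (MvPolynomial σ ℂ) K]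
    [IsFractionRing (MvPolynomial σ ℂ) K] (N D : ι → MvPolynomial σ ℂ) (R : MvPolynomial ι ℂ)
    (hR : MvPolynomial.aeval (fun e => algebraMap _ K (N e) / algebraMap _ K (D e)) R = 0)
    (t : σ → ℂ) (ht : ∀ e, MvPolynomial.eval t (D e) ≠ 0) :
    MvPolynomial.eval (fun e => MvPolynomial.eval t (N e) / MvPolynomial.eval t (D e)) R = 0 := by
  obtain ⟨O, ψ, h⟩ := exists_place_of_point (K := K) t
  obtain ⟨h1, h2⟩ := aeval_apply_of_mem ψ (fun e => (h (N e) (D e) (ht e)).1) R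
  have h3 : (fun e => ψ ⟨_, (h (N e) (D e) (ht e)).1⟩) =
      fun e => MvPolynomial.eval t (N e) / MvPolynomial.eval t (D e) :=
    funext fun e => (h (N e) (D e) (ht e)).2
  rw [h3, aeval_complex_eq_eval] at h2
  rw [← h2]
  have : (⟨_, h1⟩ : O) = 0 := Subtype.ext hR
  rw [this, map_zero]

theorem exists_eval_ne_zero {σ : Type*} {h : MvPolynomial σ ℂ} (hh : h ≠ 0) :
    ∃ t, MvPolynomial.eval t h ≠ 0 := by
  by_contra! H
  exact hh (MvPolynomial.funext fun t => by rw [H t, map_zero])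

theorem trdeg_of_isFractionRing_mvPolynomial (σ K : Type) [Field K] [Algebra ℂ K]
    [Algebra (MvPolynomial σ ℂ) K] [IsScalarTower ℂ (MvPolynomial σ ℂ) K]
    [IsFractionRing (MvPolynomial σ ℂ) K] : Algebra.trdeg ℂ K = Cardinal.mk σ := by
  have : Algebra.IsAlgebraic (MvPolynomial σ ℂ) K :=
    IsLocalization.isAlgebraic _ (nonZeroDivisors (MvPolynomial σ ℂ))
  have h := (IsTranscendenceBasis.mvPolynomial σ ℂ).algebraMap_comp (A := K)
  exact h.cardinalMk_eq_trdeg.symm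

-- With θ = p/q an integral primitive element over A = ℂ[f], the map t ↦ p(t)/q(t) is a bijection
-- from the fibre over `lam` to the roots of the minimal polynomial of θ specialised at `lam`.
open IntermediateField.algebraAdjoinAdjoin Polynomial in
theorem exists_encard_fibre_eq_finrank {σ ι K : Type} [Finite σ] [Finite ι]
    (hcard : Nat.card ι = Nat.card σ) [Field K] [Algebra ℂ K] [Algebra (MvPolynomial σ ℂ) K]
    [IsScalarTower ℂ (MvPolynomial σ ℂ) K] [IsFractionRing (MvPolynomial σ ℂ) K]
    (N D : ι → MvPolynomial σ ℂ) {h : MvPolynomial σ ℂ} (hh : h ≠ 0)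
    (hD : ∀ t, MvPolynomial.eval t h ≠ 0 → ∀ e, MvPolynomial.eval t (D e) ≠ 0) {f : ι → K}
    (hf : ∀ e, f e = algebraMap _ K (N e) / algebraMap _ K (D e))
    (hind : AlgebraicIndependent ℂ f) :
    ∃ g : MvPolynomial ι ℂ, g ≠ 0 ∧ ∀ lam : ι → ℂ, MvPolynomial.eval lam g ≠ 0 →
      {t : σ → ℂ | MvPolynomial.eval t h ≠ 0 ∧
        ∀ e, MvPolynomial.eval t (N e) = lam e * MvPolynomial.eval t (D e)}.encard =
      Module.finrank (IntermediateField.adjoin ℂ (Set.range f)) K := by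
  classical
  have := Fintype.ofFinite σ
  have hinj : Function.Injective (algebraMap (MvPolynomial σ ℂ) K) := IsFractionRing.injective _ _
  -- As many independent functions as parameters form a transcendence basis, so `K` is algebraic,
  -- and then finite, over ℂ(f).
  have htb : IsTranscendenceBasis ℂ f := by
    apply hind.isTranscendenceBasis_of_trdeg_le_of_finite
    rw [trdeg_of_isFractionRing_mvPolynomial σ K, ← Nat.cast_card, ← Nat.cast_card, hcard]
  let A := Algebra.adjoin ℂ (Set.range f)
  let k := IntermediateField.adjoin ℂ (Set.range f)
  have : Algebra.IsAlgebraic k K := htb.isAlgebraic_field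
  have : Algebra.IsAlgebraic A K := htb.isAlgebraic
  have : Algebra.EssFiniteType (MvPolynomial σ ℂ) K :=
    .of_isLocalization _ (nonZeroDivisors _)
  have : Algebra.EssFiniteType ℂ K := .comp _ (MvPolynomial σ ℂ) _
  have : Algebra.EssFiniteType k K := .of_comp ℂ k K
  have : FiniteDimensional k K := Algebra.finite_of_essFiniteType_of_isAlgebraic
  have : IsIntegrallyClosed A := IsIntegrallyClosed.of_equiv hind.aevalEquiv.toRingEquiv
  have hfaith : Function.Injective (algebraMap A K) := Subtype.val_injective
  obtain ⟨θ, hθint, hθ⟩ := exists_isIntegral_adjoin_eq_top A k K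
  obtain ⟨p, q, hq, hpq⟩ := IsFractionRing.div_surjective (A := MvPolynomial σ ℂ) θ
  have hq0 : q ≠ 0 := nonZeroDivisors.ne_zero hq
  have hqK : algebraMap _ K q ≠ 0 := by rwa [Ne, map_eq_zero_iff _ hinj]
  have hhK : algebraMap _ K h ≠ 0 := by rwa [Ne, map_eq_zero_iff _ hinj]
  obtain ⟨g₀, hg₀, hroots⟩ := exists_encard_roots_minpoly hθint hθ ℂ
  -- An equation for q over `A` with nonzero constant term: a zero of q in the fibre would force
  -- this constant term to vanish at `lam`.
  obtain ⟨Wq, hWq0, hWq⟩ := (Algebra.IsAlgebraic.isAlgebraic (R := A)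
    (algebraMap _ K q)).exists_nonzero_coeff_and_aeval_eq_zero (mem_nonZeroDivisors_of_ne_zero hqK)
  choose gX hgX WX hWX using fun i : σ => exists_mul_eq_aeval (A := A) hθ
    (algebraMap _ K (MvPolynomial.X i : MvPolynomial σ ℂ))
  obtain ⟨gh, hgh, Wh, hWh⟩ := exists_mul_eq_aeval (A := A) hθ (algebraMap _ K h)⁻¹
  obtain ⟨gq, hgq, Wq', hWq'⟩ := exists_mul_eq_aeval (A := A) hθ (algebraMap _ K q)⁻¹
  -- The factors ensure in turn that the roots are simple, that q has no zero on the fibre, that the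
  -- coordinates can be recovered from θ, and that h and q do not vanish at the point built from a
  -- root.
  let G : A := g₀ * Wq.coeff 0 * (∏ i, gX i) * gh * gq
  have hG : G ≠ 0 := by
    simp only [G]
    refine mul_ne_zero (mul_ne_zero (mul_ne_zero (mul_ne_zero hg₀ hWq0) ?_) hgh) hgq
    exact Finset.prod_ne_zero_iff.mpr fun i _ => hgX i
  refine ⟨hind.aevalEquiv.symm G, by simpa using hG, fun lam hlam => ?_⟩
  let ev : A →ₐ[ℂ] ℂ := (MvPolynomial.aeval lam).comp hind.aevalEquiv.symm.toAlgHom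
  have hevG : ev G ≠ 0 := by
    change MvPolynomial.aeval lam (hind.aevalEquiv.symm G) ≠ 0
    rwa [aeval_complex_eq_eval]
  simp only [G, map_mul, map_prod, ne_eq, mul_eq_zero, not_or, Finset.prod_eq_zero_iff,
    Finset.mem_univ, true_and, not_exists] at hevG
  obtain ⟨⟨⟨⟨hev₀, hevWq⟩, hevX⟩, hevh⟩, hevq⟩ := hevG
  have hevf : ∀ e (he : f e ∈ A), ev ⟨f e, he⟩ = lam e := by
    intro e he
    have : (⟨f e, he⟩ : A) = hind.aevalEquiv (MvPolynomial.X e) := Subtype.ext (by simp)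
    rw [this]
    change MvPolynomial.aeval lam (hind.aevalEquiv.symm _) = _
    simp
  have hmono := minpoly.aeval A θ
  have huniq : ∀ ev' : A →ₐ[ℂ] ℂ, (∀ e (he : f e ∈ A), ev' ⟨f e, he⟩ = lam e) → ev' = ev := by
    intro ev' h'
    refine AlgHom.ext fun a => ?_
    obtain ⟨P, rfl⟩ := hind.aevalEquiv.surjective a
    have : ev'.comp hind.aevalEquiv.toAlgHom = ev.comp hind.aevalEquiv.toAlgHom := by
      refine MvPolynomial.algHom_ext fun e => ?_
      have hX : hind.aevalEquiv (MvPolynomial.X e) =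
        (⟨f e, Algebra.subset_adjoin ⟨e, rfl⟩⟩ : A) := Subtype.ext (by simp)
      change ev' (hind.aevalEquiv (MvPolynomial.X e)) = ev (hind.aevalEquiv (MvPolynomial.X e))
      rw [hX, h', hevf]
    exact DFunLike.congr_fun this P
  set S := {t : σ → ℂ | MvPolynomial.eval t h ≠ 0 ∧
        ∀ e, MvPolynomial.eval t (N e) = lam e * MvPolynomial.eval t (D e)} with hS
  -- The place centred at a fibre point `t` restricts to `ev` on `A`, so identities over `A`
  -- satisfied by θ specialise to identities satisfied by p(t)/q(t).
  have forward : ∀ t ∈ S, eval₂ (ev : A →+* ℂ) (MvPolynomial.eval t p / MvPolynomial.eval t q)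
      (minpoly A θ) = 0 ∧ ∀ i, ev (gX i) * t i = eval₂ (ev : A →+* ℂ)
        (MvPolynomial.eval t p / MvPolynomial.eval t q) (WX i) := by
    rintro t ⟨ht, hNt⟩
    obtain ⟨O, ψ, hO⟩ := exists_place_of_point (K := K) t
    have hpoly : ∀ r : MvPolynomial σ ℂ, ∃ hr : algebraMap _ K r ∈ O,
        ψ ⟨_, hr⟩ = MvPolynomial.eval t r := by
      intro r
      have := hO r 1 (by simp)
      simpa using this
    have hfO : ∀ e, ∃ he : f e ∈ O, ψ ⟨_, he⟩ = lam e := by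
      intro e
      obtain ⟨h1, h2⟩ := hO (N e) (D e) (hD t ht e)
      have h3 : ψ ⟨_, h1⟩ = lam e := by rw [h2, hNt e, mul_div_cancel_right₀ _ (hD t ht e)]
      simp only [hf e]
      exact ⟨h1, h3⟩
    have hAO : A ≤ O := Algebra.adjoin_le (by rintro _ ⟨e, rfl⟩; exact (hfO e).1)
    have hψ : ψ.comp (Subalgebra.inclusion hAO) = ev := huniq _ fun e he => (hfO e).2
    have hqt : MvPolynomial.eval t q ≠ 0 := by
      intro hqt
      obtain ⟨h1, h2⟩ := exists_apply_aeval_eq_eval₂ ψ hAO (hpoly q).1 Wq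
      rw [hψ, (hpoly q).2, hqt, eval₂_at_zero] at h2
      have h0 : (⟨_, h1⟩ : O) = 0 := Subtype.ext hWq
      rw [h0, map_zero] at h2
      exact hevWq h2.symm
    obtain ⟨h1, h2⟩ := hO p q hqt
    have hθO : ∃ hθO : θ ∈ O, ψ ⟨θ, hθO⟩ = MvPolynomial.eval t p / MvPolynomial.eval t q := by
      rw [← hpq] 
      exact ⟨h1, h2⟩
    obtain ⟨hθO, hθt⟩ := hθO
    constructor
    · obtain ⟨h1, h2⟩ := exists_apply_aeval_eq_eval₂ ψ hAO hθO (minpoly A θ)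
      rw [hψ, hθt] at h2
      rw [← h2]
      have h0 : (⟨_, h1⟩ : O) = 0 := Subtype.ext hmono
      rw [h0, map_zero]
    · intro i
      obtain ⟨h1, h2⟩ := exists_apply_aeval_eq_eval₂ ψ hAO hθO (WX i)
      rw [hψ, hθt] at h2
      rw [← h2]
      have h0 : (⟨_, h1⟩ : O) = Subalgebra.inclusion hAO (gX i) *
        ⟨_, (hpoly (MvPolynomial.X i)).1⟩ := Subtype.ext (hWX i).symm
      rw [h0, map_mul, (hpoly _).2, MvPolynomial.eval_X, ← hψ]
      rfl
  -- A root x extends `ev` to A[θ], because A[θ] is the quotient of A[X] by the minimal polynomial.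
  -- The extension to a local ring has the coordinate functions in its domain, and their values are
  -- the point sought.
  have backward : ∀ x, eval₂ (ev : A →+* ℂ) x (minpoly A θ) = 0 →
      ∃ t ∈ S, MvPolynomial.eval t p / MvPolynomial.eval t q = x := by
    intro x hx
    let B := Algebra.adjoin A {θ}
    let r : B →+* ℂ := (AdjoinRoot.lift (ev : A →+* ℂ) x hx).comp
      (minpoly.equivAdjoin hθint).symm.toRingEquiv.toRingHom
    have hrA : ∀ a : A, r (algebraMap A B a) = ev a := by
      intro a
      change AdjoinRoot.lift (ev : A →+* ℂ) x hx ((minpoly.equivAdjoin hθint).symm _) = _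
      rw [AlgEquiv.commutes, AdjoinRoot.algebraMap_eq, AdjoinRoot.lift_of]
      rfl
    have hθB : θ ∈ B := Algebra.self_mem_adjoin_singleton A θ
    have hrθ : r ⟨θ, hθB⟩ = x := by
      change AdjoinRoot.lift (ev : A →+* ℂ) x hx ((minpoly.equivAdjoin hθint).symm _) = _
      have : (⟨θ, hθB⟩ : B) = minpoly.equivAdjoin hθint (AdjoinRoot.root _) :=
        Subtype.ext (by simp)
      rw [this, AlgEquiv.symm_apply_apply, AdjoinRoot.lift_root]
    let χ : B →ₐ[ℂ] ℂ := { r with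
      commutes' := fun c => by
        change r (algebraMap ℂ B c) = _
        rw [IsScalarTower.algebraMap_apply ℂ A B, hrA, AlgHom.commutes] }
    have : IsScalarTower ℂ B K := .of_algebraMap_eq fun _ => rfl
    obtain ⟨O, ψ, hO⟩ := exists_extension_to_localRing (F := ℂ) (A := B) (K := K)
      Subtype.val_injective χ
    have hBO : ∀ b : B, ∃ hb : (b : K) ∈ O, ψ ⟨b, hb⟩ = r b := by
      intro b
      obtain ⟨h1, h2⟩ := hO b 1 b (by simp) (by simp [Subalgebra.algebraMap_eq])
      rw [map_one, mul_one] at h2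
      exact ⟨h1, h2⟩
    have hmem : ∀ (g : A) (κ : K) (W : A[X]), ev g ≠ 0 → algebraMap A K g * κ = aeval θ W →
        κ ∈ O := by
      intro g κ W hg hW
      have hWB : aeval θ W ∈ B := aeval_mem_adjoin_singleton A θ
      refine (hO ⟨_, hWB⟩ (algebraMap A B g) κ ?_ ?_).1
      · change r _ ≠ 0
        rwa [hrA]
      · rw [mul_comm]
        exact hW
    have hXO : ∀ i : σ, algebraMap _ K (MvPolynomial.X i : MvPolynomial σ ℂ) ∈ O :=
      fun i => hmem _ _ _ (hevX i) (hWX i)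
    let t : σ → ℂ := fun i => ψ ⟨_, hXO i⟩
    have hpoly : ∀ r : MvPolynomial σ ℂ, ∃ hr : algebraMap _ K r ∈ O,
        ψ ⟨_, hr⟩ = MvPolynomial.eval t r := by
      intro r
      have h1 := aeval_apply_of_mem ψ hXO r
      have h2 : MvPolynomial.aeval (fun i : σ => algebraMap _ K
          (MvPolynomial.X i : MvPolynomial σ ℂ)) r =
          algebraMap (MvPolynomial σ ℂ) K r := by
        have := MvPolynomial.comp_aeval_apply (MvPolynomial.X : σ → MvPolynomial σ ℂ)
          (IsScalarTower.toAlgHom ℂ (MvPolynomial σ ℂ) K) r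
        rw [MvPolynomial.aeval_X_left_apply] at this
        exact this.symm
      simp only [h2, aeval_complex_eq_eval] at h1
      exact h1
    have hinv : ∀ (r : MvPolynomial σ ℂ), algebraMap _ K r ≠ 0 → (algebraMap _ K r)⁻¹ ∈ O →
        MvPolynomial.eval t r ≠ 0 := by
      intro r hr hrO h0
      have h1 : (⟨_, (hpoly r).1⟩ : O) * ⟨_, hrO⟩ = 1 := Subtype.ext (mul_inv_cancel₀ hr)
      have h2 := congrArg ψ h1
      rw [map_mul, (hpoly r).2, h0, zero_mul, map_one] at h2
      exact zero_ne_one h2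
    have hht := hinv h hhK (hmem _ _ _ hevh hWh)
    have hqt := hinv q hqK (hmem _ _ _ hevq hWq')
    refine ⟨t, ⟨hht, fun e => ?_⟩, ?_⟩
    · have hDe : algebraMap _ K (D e) ≠ 0 := by
        rw [Ne, map_eq_zero_iff _ hinj]
        intro h0
        exact hD t hht e (by rw [h0, map_zero])
      have hfA : f e ∈ A := Algebra.subset_adjoin ⟨e, rfl⟩
      obtain ⟨h1, h2⟩ := hBO (algebraMap A B ⟨f e, hfA⟩)
      rw [hrA, hevf] at h2
      have h3 : (⟨_, (hpoly (N e)).1⟩ : O) = ⟨_, h1⟩ * ⟨_, (hpoly (D e)).1⟩ := by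
        refine Subtype.ext ?_
        change _ = f e * _
        rw [hf e, div_mul_cancel₀ _ hDe]
      rw [← (hpoly (N e)).2, h3, map_mul, h2, (hpoly (D e)).2]
    · obtain ⟨h1, h2⟩ := hBO ⟨θ, hθB⟩
      rw [hrθ] at h2
      have h3 : (⟨_, (hpoly p).1⟩ : O) = ⟨_, h1⟩ * ⟨_, (hpoly q).1⟩ := by
        refine Subtype.ext ?_
        change _ = θ * _
        rw [← hpq, div_mul_cancel₀ _ hqK]
      rw [div_eq_iff hqt, ← (hpoly p).2, h3, map_mul, h2, (hpoly q).2]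
  rw [← hroots (ev : A →+* ℂ) hev₀]
  have himg : {x : ℂ | eval₂ (ev : A →+* ℂ) x (minpoly A θ) = 0} =
      (fun t => MvPolynomial.eval t p / MvPolynomial.eval t q) '' S := by
    ext x
    constructor
    · exact fun hx => backward x hx
    · rintro ⟨t, ht, rfl⟩
      exact (forward t ht).1
  rw [himg]
  refine (Set.InjOn.encard_image ?_).symm
  -- The value of θ determines every coordinate, since `gX i` does not vanish at `lam`.
  intro t ht t' ht' htt'
  funext i
  have h1 := (forward t ht).2 i
  have h2 := (forward t' ht').2 i
  simp only at htt'
  rw [htt', ← h2] at h1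
  exact mul_left_cancel₀ (hevX i) h1

open Classical in
/-- A general fibre of a rational map between affine spaces of the same dimension has as many points
as the degree of the extension of function fields if the map is dominant, and none otherwise. -/
theorem exists_encard_fibre_eq {σ ι K : Type} [Finite σ] [Finite ι]
    (hcard : Nat.card ι = Nat.card σ) [Field K] [Algebra ℂ K] [Algebra (MvPolynomial σ ℂ) K]
    [IsScalarTower ℂ (MvPolynomial σ ℂ) K] [IsFractionRing (MvPolynomial σ ℂ) K]
    (N D : ι → MvPolynomial σ ℂ) {h : MvPolynomial σ ℂ} (hh : h ≠ 0)
    (hD : ∀ t, MvPolynomial.eval t h ≠ 0 → ∀ e, MvPolynomial.eval t (D e) ≠ 0) {f : ι → K}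
    (hf : ∀ e, f e = algebraMap _ K (N e) / algebraMap _ K (D e)) :
    ∃ g : MvPolynomial ι ℂ, g ≠ 0 ∧ ∀ lam : ι → ℂ, MvPolynomial.eval lam g ≠ 0 →
      {t : σ → ℂ | MvPolynomial.eval t h ≠ 0 ∧
        ∀ e, MvPolynomial.eval t (N e) = lam e * MvPolynomial.eval t (D e)}.encard =
      ((if AlgebraicIndependent ℂ f then
        Module.finrank (IntermediateField.adjoin ℂ (Set.range f)) K else 0 : ℕ) : ℕ∞) := by
  by_cases hind : AlgebraicIndependent ℂ f
  · simp only [hind, if_true]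
    exact exists_encard_fibre_eq_finrank hcard N D hh hD hf hind
  · simp only [hind, if_false, Nat.cast_zero, Set.encard_eq_zero, Set.eq_empty_iff_forall_notMem]
    -- A nontrivial relation between the components holds at every point of the image, so fibres off
    -- its zero locus are empty.
    rw [algebraicIndependent_iff] at hind
    push Not at hind
    obtain ⟨g, hg, hg0⟩ := hind
    refine ⟨g, hg0, fun lam hlam t ⟨ht, hNt⟩ => hlam ?_⟩
    have hf' : f = fun e => algebraMap _ K (N e) / algebraMap _ K (D e) := funext hf
    rw [hf'] at hg
    have := eval_eq_zero_of_aeval_div_eq_zero N D g hg t (hD t ht)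
    simp only [hNt, fun e => mul_div_cancel_right₀ (lam e) (hD t ht e)] at this
    exact this

end
end CrossRatio

namespace CrossRatio
noncomputable section

/-! ### Brackets and cross-ratios -/

section Bracket

variable {K : Type*} [Field K]

@[simp] theorem bracket_self (p : Fin 2 → K) : bracket p p = 0 := by
  simp only [bracket]; ring

theorem bracket_smul_left (c : K) (p q : Fin 2 → K) : bracket (c • p) q = c * bracket p q := by
  simp only [bracket, Pi.smul_apply, smul_eq_mul]; ring

theorem bracket_smul_right (c : K) (p q : Fin 2 → K) : bracket p (c • q) = c * bracket p q := by
  simp only [bracket, Pi.smul_apply, smul_eq_mul]; ring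

theorem crossRatio_smul {c₁ c₂ c₃ c₄ : K} (h₁ : c₁ ≠ 0) (h₂ : c₂ ≠ 0) (h₃ : c₃ ≠ 0) (h₄ : c₄ ≠ 0)
    (p₁ p₂ p₃ p₄ : Fin 2 → K) :
    crossRatio (c₁ • p₁) (c₂ • p₂) (c₃ • p₃) (c₄ • p₄) = crossRatio p₁ p₂ p₃ p₄ := by
  simp only [crossRatio, bracket_smul_left, bracket_smul_right]
  rw [← mul_div_mul_left (bracket p₃ p₁ * bracket p₄ p₂) _
    (mul_ne_zero (mul_ne_zero h₁ h₂) (mul_ne_zero h₃ h₄))]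
  congr 1 <;> ring

theorem crossRatio_map {φ : (Fin 2 → K) → (Fin 2 → K)} {δ : K} (hδ : δ ≠ 0)
    (h : ∀ p q, bracket (φ p) (φ q) = δ * bracket p q) (p₁ p₂ p₃ p₄ : Fin 2 → K) :
    crossRatio (φ p₁) (φ p₂) (φ p₃) (φ p₄) = crossRatio p₁ p₂ p₃ p₄ := by
  simp only [crossRatio, h]
  rw [← mul_div_mul_left (bracket p₃ p₁ * bracket p₄ p₂) _ (mul_ne_zero hδ hδ)]
  congr 1 <;> ring

theorem crossRatio_ratCast_map {L : Type*} [Field L] (φ : K →+* L) (p₁ p₂ p₃ p₄ : Fin 2 → K) :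
    φ (crossRatio p₁ p₂ p₃ p₄) = crossRatio (φ ∘ p₁) (φ ∘ p₂) (φ ∘ p₃) (φ ∘ p₄) := by
  simp [crossRatio, bracket]

/-- The cross-ratios of the hyperedges, for points with given homogeneous coordinates. -/
def edgeCrossRatio {n : ℕ} (T : Fin (n - 3) → (Fin 4 ↪ Fin n)) (z : Fin n → Fin 2 → K)
    (e : Fin (n - 3)) : K :=
  crossRatio (z (T e 0)) (z (T e 1)) (z (T e 2)) (z (T e 3))

end Bracket

-- ℂ(s) is algebraic over ℂ[s], which is a quotient of a polynomial ring in the elements of `s`; so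
-- its transcendence degree is at most the cardinality of `s`.
open IntermediateField.algebraAdjoinAdjoin in
theorem not_algebraicIndependent_of_mem_adjoin {K ι : Type} [Field K] [Algebra ℂ K] [Finite ι]
    {s : Set K} [Finite s] {f : ι → K} (hf : ∀ i, f i ∈ IntermediateField.adjoin ℂ s)
    (hcard : Nat.card s < Nat.card ι) : ¬ AlgebraicIndependent ℂ f := by
  intro hind
  let f' : ι → IntermediateField.adjoin ℂ s := fun i => ⟨f i, hf i⟩
  have hind' : AlgebraicIndependent ℂ f' :=
    AlgebraicIndependent.of_comp (IntermediateField.adjoin ℂ s).val hind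
  have h1 := hind'.cardinalMk_le_trdeg
  have : FaithfulSMul ℂ (Algebra.adjoin ℂ s) :=
    (faithfulSMul_iff_algebraMap_injective _ _).mpr fun _ _ h =>
      (algebraMap ℂ K).injective (congrArg Subtype.val h)
  have h2 : Algebra.trdeg ℂ (Algebra.adjoin ℂ s) +
      Algebra.trdeg (Algebra.adjoin ℂ s) (IntermediateField.adjoin ℂ s) =
      Algebra.trdeg ℂ (IntermediateField.adjoin ℂ s) := trdeg_add_eq ..
  have h0 : Algebra.trdeg (Algebra.adjoin ℂ s) (IntermediateField.adjoin ℂ s) = 0 :=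
    trdeg_eq_zero
  rw [h0, add_zero] at h2
  have h3 : Algebra.trdeg ℂ (Algebra.adjoin ℂ s) ≤ Cardinal.mk s := by
    have hsurj : Function.Surjective ((Subalgebra.inclusion (by
      rw [Algebra.adjoin_eq_range])).comp
        (MvPolynomial.aeval ((↑) : s → K)).rangeRestrict :
          MvPolynomial s ℂ →ₐ[ℂ] Algebra.adjoin ℂ s) := by
      rintro ⟨x, hx⟩
      have hx' := hx
      rw [Algebra.adjoin_eq_range] at hx'
      obtain ⟨P, rfl⟩ := hx'
      exact ⟨P, rfl⟩
    simpa using trdeg_le_of_surjective _ hsurj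
  have h4 := (h1.trans h2.symm.le).trans h3
  rw [← Nat.cast_card, ← Nat.cast_card, Nat.cast_le] at h4
  omega

/-- The cross-ratios of points that are determined by fewer than `n` of them are algebraically
dependent. -/
theorem exists_relation_of_not_surjective {n : ℕ} (hn : 4 ≤ n) (T : Fin (n - 3) → (Fin 4 ↪ Fin n))
    (ρ : Fin n → Fin n) (hρ : ¬ Function.Surjective ρ) :
    ∃ R : MvPolynomial (Fin (n - 3)) ℂ, R ≠ 0 ∧ ∀ z : Fin n → Fin 2 → ℂ,
      (∀ e i j, i ≠ j → bracket (z (ρ (T e i))) (z (ρ (T e j))) ≠ 0) →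
      MvPolynomial.eval (edgeCrossRatio T (z ∘ ρ)) R = 0 := by
  classical
  by_cases hT : ∀ e, Function.Injective (ρ ∘ T e)
  swap
  · push Not at hT
    obtain ⟨e, he⟩ := hT
    simp only [Function.Injective] at he
    push Not at he
    obtain ⟨i, j, hij, hne⟩ := he
    -- If two vertices of a hyperedge are identified, the hypothesis on `z` fails.
    refine ⟨1, one_ne_zero, fun z hz => absurd ?_ (hz e i j hne)⟩
    simp only [Function.comp_apply] at hij
    rw [hij, bracket_self]
  let P := MvPolynomial (Fin n × Fin 2) ℂ
  let K := FractionRing P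
  let x : Fin n × Fin 2 → P := MvPolynomial.X
  let p : Fin n → Fin 2 → K := fun v i => algebraMap P K (x (v, i))
  let e₀ : Fin (n - 3) := ⟨0, by omega⟩
  let a := ρ (T e₀ 0)
  let b := ρ (T e₀ 1)
  let c := ρ (T e₀ 2)
  have hab : a ≠ b := fun h => absurd (hT e₀ h) (by decide)
  have hac : a ≠ c := fun h => absurd (hT e₀ h) (by decide)
  have hbc : b ≠ c := fun h => absurd (hT e₀ h) (by decide)
  have hinj : Function.Injective (algebraMap P K) := IsFractionRing.injective _ _
  have hpne : ∀ v w, v ≠ w → bracket (p v) (p w) ≠ 0 := by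
    intro v w hvw h0
    have h1 : algebraMap P K (x (v, 0) * x (w, 1) - x (v, 1) * x (w, 0)) = 0 := by
      rw [map_sub, map_mul, map_mul]
      exact h0
    rw [map_eq_zero_iff _ hinj] at h1
    have h2 := congrArg (MvPolynomial.eval fun i : Fin n × Fin 2 =>
      if i = (v, 0) ∨ i = (w, 1) then (1 : ℂ) else 0) h1
    simp [x, hvw, hvw.symm] at h2
  let α := (bracket (p c) (p a))⁻¹
  let β := (bracket (p c) (p b))⁻¹
  have hα : α ≠ 0 := inv_ne_zero (hpne _ _ hac.symm)
  have hβ : β ≠ 0 := inv_ne_zero (hpne _ _ hbc.symm)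
  -- The Möbius transformation taking the generic points a, b, c to 0, ∞, 1. Cross-ratios are
  -- unchanged by it, so they are rational in the affine coordinates `u` of the remaining points.
  let φ : (Fin 2 → K) → (Fin 2 → K) := fun y => ![α * bracket y (p a), β * bracket y (p b)]
  have hφ : ∀ y w, bracket (φ y) (φ w) = (α * β * bracket (p a) (p b)) * bracket y w := by
    intro y w
    simp only [φ, bracket, Matrix.cons_val_zero, Matrix.cons_val_one]
    ring
  have hφ0 : α * β * bracket (p a) (p b) ≠ 0 := mul_ne_zero (mul_ne_zero hα hβ) (hpne _ _ hab)
  let u : Fin n → K := fun w => (α * bracket (p w) (p a)) / (β * bracket (p w) (p b))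
  let W : Finset (Fin n) := (Finset.univ.image ρ) \ {a, b, c}
  let s : Set K := u '' (W : Set (Fin n))
  let k := IntermediateField.adjoin ℂ s
  -- The image of ρ has fewer than n elements, and three of them have been normalised away.
  have hWcard : W.card < n - 3 := by
    have h1 : ({a, b, c} : Finset (Fin n)).card = 3 := by
      rw [Finset.card_eq_three]; exact ⟨a, b, c, hab, hac, hbc, rfl⟩
    have h2 : ({a, b, c} : Finset (Fin n)) ⊆ Finset.univ.image ρ := by
      intro v hv
      simp only [Finset.mem_insert, Finset.mem_singleton] at hv
      rcases hv with rfl | rfl | rfl <;> simp [a, b, c]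
    have h3 : (Finset.univ.image ρ).card < n := by
      have h4 : (Finset.univ.image ρ) ≠ Finset.univ := fun h => hρ fun v => by
        have := h ▸ Finset.mem_univ v
        simpa using this
      have := Finset.card_lt_card (Finset.ssubset_univ_iff.mpr h4)
      simpa using this
    have h5 := Finset.card_sdiff_of_subset h2
    change W.card = _ at h5
    omega
  have hscard : Nat.card s < Nat.card (Fin (n - 3)) := by
    rw [Nat.card_fin]
    refine lt_of_le_of_lt (Set.ncard_image_le W.finite_toSet) ?_
    rwa [Set.ncard_coe_finset]
  have hq : ∀ v, ∃ (m : K) (q : Fin 2 → k), m ≠ 0 ∧ m • (fun i => (q i : K)) = φ (p (ρ v)) := by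
    intro v
    by_cases hva : ρ v = a
    · refine ⟨β * bracket (p a) (p b), ![0, 1], mul_ne_zero hβ (hpne _ _ hab), ?_⟩
      ext i; fin_cases i <;> simp [φ, hva]
    by_cases hvb : ρ v = b
    · refine ⟨α * bracket (p b) (p a), ![1, 0], mul_ne_zero hα (hpne _ _ hab.symm), ?_⟩
      ext i; fin_cases i <;> simp [φ, hvb]
    by_cases hvc : ρ v = c
    · refine ⟨1, ![1, 1], one_ne_zero, ?_⟩
      have h1 : α * bracket (p c) (p a) = 1 := inv_mul_cancel₀ (hpne _ _ hac.symm)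
      have h2 : β * bracket (p c) (p b) = 1 := inv_mul_cancel₀ (hpne _ _ hbc.symm)
      ext i; fin_cases i <;> simp [φ, hvc, h1, h2]
    have hmem : u (ρ v) ∈ k := IntermediateField.subset_adjoin _ _
      ⟨ρ v, by simp [W, hva, hvb, hvc], rfl⟩
    have hne : β * bracket (p (ρ v)) (p b) ≠ 0 := mul_ne_zero hβ (hpne _ _ hvb)
    refine ⟨β * bracket (p (ρ v)) (p b), ![⟨_, hmem⟩, 1], hne, ?_⟩
    ext i; fin_cases i
    · simp [φ, u, mul_div_cancel₀ _ hne]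
    · simp [φ]
  choose m q hm hmq using hq
  have hmem : ∀ e, edgeCrossRatio T (p ∘ ρ) e ∈ k := by
    intro e
    have h1 : edgeCrossRatio T (p ∘ ρ) e = edgeCrossRatio T (fun v i => (q v i : K)) e := by
      simp only [edgeCrossRatio, Function.comp_apply]
      rw [← crossRatio_map hφ0 hφ, ← hmq, ← hmq, ← hmq, ← hmq,
        crossRatio_smul (hm _) (hm _) (hm _) (hm _)]
    have h2 : edgeCrossRatio T (fun v i => (q v i : K)) e = (edgeCrossRatio T q e : k) :=
      (crossRatio_ratCast_map (algebraMap k K) _ _ _ _).symm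
    rw [h1, h2]
    exact SetLike.coe_mem _
  have : Finite s := Set.Finite.image _ W.finite_toSet
  have hdep := not_algebraicIndependent_of_mem_adjoin hmem hscard
  rw [algebraicIndependent_iff] at hdep
  push Not at hdep
  obtain ⟨R, hR, hR0⟩ := hdep
  refine ⟨R, hR0, fun z hz => ?_⟩
  -- The relation found for generic points specialises to `z`, as the denominators of the
  -- cross-ratios do not vanish there.
  let br : Fin n → Fin n → P := fun v w => x (v, 0) * x (w, 1) - x (v, 1) * x (w, 0)
  let N : Fin (n - 3) → P := fun e => br (ρ (T e 2)) (ρ (T e 0)) * br (ρ (T e 3)) (ρ (T e 1))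
  let D : Fin (n - 3) → P := fun e => br (ρ (T e 2)) (ρ (T e 1)) * br (ρ (T e 3)) (ρ (T e 0))
  let t : Fin n × Fin 2 → ℂ := fun i => z i.1 i.2
  have hbr : ∀ v w, MvPolynomial.eval t (br v w) = bracket (z v) (z w) := by
    intro v w
    simp [br, x, t, bracket]
  have hbrK : ∀ v w, algebraMap P K (br v w) = bracket (p v) (p w) := by
    intro v w
    simp [br, p, bracket]
  have := eval_eq_zero_of_aeval_div_eq_zero (K := K) N D R (by
    rw [← hR]
    congr 2
    funext e
    simp only [N, D, map_mul, ← hbrK, edgeCrossRatio, crossRatio, Function.comp_apply]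
    rfl) t (fun e => by
    simp only [D, map_mul, hbr]
    exact mul_ne_zero (hz e 2 1 (by decide)) (hz e 3 0 (by decide)))
  rw [← this]
  congr 2
  funext e
  simp only [N, D, map_mul, hbr, edgeCrossRatio, crossRatio, Function.comp_apply]

end
end CrossRatio

namespace CrossRatio
noncomputable section
open MvPolynomial

/-! ### Multihomogeneous forms -/

section Forms

variable {S : Type*}

theorem prod_weight_pow (m : S × Fin 2 →₀ ℕ) (c : S → ℂ) :
    (Finsupp.weight (fun i : S × Fin 2 => Finsupp.single i.1 1) m).prod (fun s k => c s ^ k) =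
      m.prod fun i k => c i.1 ^ k := by
  classical
  induction m using Finsupp.induction_linear with
  | zero => simp
  | add f g hf hg =>
    rw [map_add, Finsupp.prod_add_index' (by simp) (fun _ _ _ => pow_add _ _ _),
      Finsupp.prod_add_index' (by simp) (fun _ _ _ => pow_add _ _ _), hf, hg]
  | single i k => simp [Finsupp.weight_single]

theorem IsMultihomogeneous.eval_smul {F : MvPolynomial (S × Fin 2) ℂ} {d : S →₀ ℕ}
    (hF : IsMultihomogeneous F d) (c : S → ℂ) (x : S × Fin 2 → ℂ) :
    eval (fun i => c i.1 * x i) F = d.prod (fun s k => c s ^ k) * eval x F := by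
  induction hF using IsWeightedHomogeneous.induction_on with
  | zero => simp
  | add p q _ _ hp hq => rw [map_add, map_add, hp, hq, mul_add]
  | monomial m r hr =>
    rw [eval_monomial, eval_monomial, ← hr, prod_weight_pow]
    simp only [mul_pow, Finsupp.prod_mul]
    ring

theorem IsMultihomogeneous.isHomogeneous {F : MvPolynomial (S × Fin 2) ℂ} {d : S →₀ ℕ}
    (hF : IsMultihomogeneous F d) : F.IsHomogeneous d.degree := by
  intro m hm
  rw [← hF hm]
  clear hm
  change Finsupp.weight (fun _ => 1) m = _
  rw [← Finsupp.degree_eq_weight_one]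
  induction m using Finsupp.induction_linear with
  | zero => simp
  | add f g hf hg => rw [map_add, map_add, map_add, hf, hg]
  | single i k => simp [Finsupp.weight_single]

theorem IsMultihomogeneous.mul {F G : MvPolynomial (S × Fin 2) ℂ} {d d' : S →₀ ℕ}
    (hF : IsMultihomogeneous F d) (hG : IsMultihomogeneous G d') :
    IsMultihomogeneous (F * G) (d + d') := IsWeightedHomogeneous.mul hF hG

theorem isMultihomogeneous_X (i : S × Fin 2) :
    IsMultihomogeneous (X i : MvPolynomial (S × Fin 2) ℂ) (Finsupp.single i.1 1) :=
  isWeightedHomogeneous_X ℂ _ i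

/-- `w` is a system of homogeneous coordinates of `P`. -/
def IsCoords (P : P1Pow S) (w : S × Fin 2 → ℂ) : Prop :=
  ∃ c : S → ℂ, (∀ s, c s ≠ 0) ∧ P.coords = fun i => c i.1 * w i

theorem IsCoords.exists_evalAt {P : P1Pow S} {w : S × Fin 2 → ℂ} (h : IsCoords P w) :
    ∃ c : S → ℂ, (∀ s, c s ≠ 0) ∧ ∀ F d, IsMultihomogeneous F d →
      P.evalAt F = d.prod (fun s k => c s ^ k) * eval w F := by
  obtain ⟨c, hc, hw⟩ := h
  refine ⟨c, hc, fun F d hF => ?_⟩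
  rw [P1Pow.evalAt, hw, hF.eval_smul]

theorem IsCoords.evalAt_eq_zero_iff {P : P1Pow S} {w : S × Fin 2 → ℂ} (h : IsCoords P w)
    {F : MvPolynomial (S × Fin 2) ℂ} {d : S →₀ ℕ} (hF : IsMultihomogeneous F d) :
    P.evalAt F = 0 ↔ eval w F = 0 := by
  obtain ⟨c, hc, h⟩ := h.exists_evalAt
  rw [h F d hF, mul_eq_zero, or_iff_right]
  exact Finset.prod_ne_zero_iff.mpr fun s _ => pow_ne_zero _ (hc s)

theorem isCoords_of_mk {P : P1Pow S} {w : S → Fin 2 → ℂ} (hw : ∀ s, w s ≠ 0)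
    (h : ∀ s, P s = Projectivization.mk ℂ (w s) (hw s)) : IsCoords P fun i => w i.1 i.2 := by
  choose a ha using fun s => Projectivization.exists_smul_eq_mk_rep ℂ (w s) (hw s)
  refine ⟨fun s => a s, fun s => (a s).ne_zero, ?_⟩
  funext i
  rw [P1Pow.coords, h i.1, ← ha i.1]
  rfl

theorem isOpen_evalAt_ne_zero {F : MvPolynomial (S × Fin 2) ℂ} {d : S →₀ ℕ}
    (hF : IsMultihomogeneous F d) : IsOpen {P : P1Pow S | P.evalAt F ≠ 0} :=
  TopologicalSpace.isOpen_generateFrom_of_mem ⟨F, d, hF, rfl⟩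

theorem isClosed_evalAt_eq_zero {F : MvPolynomial (S × Fin 2) ℂ} {d : S →₀ ℕ}
    (hF : IsMultihomogeneous F d) : IsClosed {P : P1Pow S | P.evalAt F = 0} := by
  rw [← isOpen_compl_iff]
  exact isOpen_evalAt_ne_zero hF

/-- The bracket of the `s`-th coordinates and the image of the `s'`-th coordinates under `B`. -/
def bracketForm (s s' : S) (B : Matrix (Fin 2) (Fin 2) ℂ) : MvPolynomial (S × Fin 2) ℂ :=
  X (s, 0) * (C (B 1 0) * X (s', 0) + C (B 1 1) * X (s', 1)) -
    X (s, 1) * (C (B 0 0) * X (s', 0) + C (B 0 1) * X (s', 1))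

theorem isMultihomogeneous_bracketForm (s s' : S) (B : Matrix (Fin 2) (Fin 2) ℂ) :
    IsMultihomogeneous (bracketForm s s' B) (Finsupp.single s 1 + Finsupp.single s' 1) := by
  have h : ∀ i, IsWeightedHomogeneous (fun i : S × Fin 2 => Finsupp.single i.1 1)
      (C (B i 0) * X (s', 0) + C (B i 1) * X (s', 1)) (Finsupp.single s' 1) := fun i =>
    (IsWeightedHomogeneous.C_mul (isMultihomogeneous_X (s', 0)) _).add
      (IsWeightedHomogeneous.C_mul (isMultihomogeneous_X (s', 1)) _)
  exact ((isMultihomogeneous_X (s, 0)).mul (h 1)).sub ((isMultihomogeneous_X (s, 1)).mul (h 0))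

theorem eval_bracketForm (s s' : S) (B : Matrix (Fin 2) (Fin 2) ℂ) (w : S × Fin 2 → ℂ) :
    eval w (bracketForm s s' B) =
      bracket (fun i => w (s, i)) (B.mulVec fun i => w (s', i)) := by
  simp [bracketForm, bracket, Matrix.mulVec, dotProduct, Fin.sum_univ_two]

end Forms

/-! ### The projective line -/

theorem bracket_eq_zero_iff {p q : Fin 2 → ℂ} (hp : p ≠ 0) (hq : q ≠ 0) :
    bracket p q = 0 ↔ Projectivization.mk ℂ p hp = Projectivization.mk ℂ q hq := by
  rw [Projectivization.mk_eq_mk_iff']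
  constructor
  · intro h
    simp only [bracket] at h
    by_cases h0 : q 0 = 0
    · have h1 : q 1 ≠ 0 := fun h1 => hq (by ext i; fin_cases i <;> simpa)
      refine ⟨p 1 / q 1, ?_⟩
      ext i; fin_cases i
      · have : p 0 = 0 := by simpa [h0, h1] using h
        simp [h0, this]
      · simp [h1]
    · refine ⟨p 0 / q 0, ?_⟩
      ext i; fin_cases i
      · simp [h0]
      · simp
        field_simp
        linear_combination h
  · rintro ⟨a, rfl⟩
    rw [bracket_smul_left, bracket_self, mul_zero]

theorem bracket_rep_eq_zero_iff (x y : P1) : bracket x.rep y.rep = 0 ↔ x = y := by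
  rw [bracket_eq_zero_iff x.rep_nonzero y.rep_nonzero, x.mk_rep, y.mk_rep]

open scoped MatrixGroups in
theorem bracket_smul_smul (g : GL (Fin 2) ℂ) (p q : Fin 2 → ℂ) :
    bracket (g • p) (g • q) = g.val.det * bracket p q := by
  change bracket (g.val.mulVec p) (g.val.mulVec q) = _
  simp only [bracket, Matrix.mulVec, dotProduct, Fin.sum_univ_two, Matrix.det_fin_two]
  ring

theorem eval_smul_of_isHomogeneous {σ : Type*} {a : MvPolynomial σ ℂ} {k : ℕ}
    (ha : a.IsHomogeneous k) (c : ℂ) (x : σ → ℂ) : eval (c • x) a = c ^ k * eval x a := by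
  induction ha using IsWeightedHomogeneous.induction_on with
  | zero => simp
  | add p q _ _ hp hq => rw [map_add, map_add, hp, hq, mul_add]
  | monomial m r hr =>
    change Finsupp.weight (fun _ => 1) m = _ at hr
    rw [← Finsupp.degree_eq_weight_one] at hr
    rw [eval_monomial, eval_monomial, ← hr, Finsupp.degree_apply, ← Finset.prod_pow_eq_pow_sum]
    simp only [Pi.smul_apply, smul_eq_mul, mul_pow, Finsupp.prod_mul]
    simp only [Finsupp.prod]
    ring

theorem mk_affine_ne_zero (t : ℂ) : (![t, 1] : Fin 2 → ℂ) ≠ 0 := fun h => by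
  have := congrFun h 1
  simp at this

theorem mk_infinity_ne_zero : (![1, 0] : Fin 2 → ℂ) ≠ 0 := fun h => by
  have := congrFun h 0
  simp at this

/-- The point of `ℙ¹` with affine coordinate `t`. -/
def affinePoint (t : ℂ) : P1 := Projectivization.mk ℂ ![t, 1] (mk_affine_ne_zero t)

/-- The point `∞` of `ℙ¹`. -/
def infinityPoint : P1 := Projectivization.mk ℂ ![1, 0] mk_infinity_ne_zero

/-- The affine coordinate of a point of `ℙ¹` other than `∞`. -/
def affineCoord (u : P1) : ℂ := u.rep 0 / u.rep 1

theorem rep_one_ne_zero {u : P1} (hu : u ≠ infinityPoint) : u.rep 1 ≠ 0 := by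
  intro h
  apply hu
  rw [← u.mk_rep, infinityPoint, ← bracket_eq_zero_iff]
  simp [bracket, h]

theorem rep_eq_smul {u : P1} (hu : u ≠ infinityPoint) : u.rep = u.rep 1 • ![affineCoord u, 1] := by
  have h := rep_one_ne_zero hu
  ext i; fin_cases i
  · simp [affineCoord]; field_simp
  · simp

theorem affinePoint_affineCoord {u : P1} (hu : u ≠ infinityPoint) :
    affinePoint (affineCoord u) = u := by
  have h := rep_one_ne_zero hu
  conv_rhs => rw [← u.mk_rep]
  rw [affinePoint, ← bracket_eq_zero_iff]
  simp [bracket, affineCoord, h]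

theorem affinePoint_injective : Function.Injective affinePoint := by
  intro t t' h
  rw [affinePoint, affinePoint, ← bracket_eq_zero_iff] at h
  simpa [bracket, sub_eq_zero] using h

theorem affinePoint_ne_infinityPoint (t : ℂ) : affinePoint t ≠ infinityPoint := by
  rw [affinePoint, infinityPoint, Ne, ← bracket_eq_zero_iff]
  simp [bracket]

/-- The polynomial `a(t, 1)`. -/
def dehomogenize (a : MvPolynomial (Fin 2) ℂ) : Polynomial ℂ := aeval ![Polynomial.X, 1] a

theorem eval_dehomogenize (a : MvPolynomial (Fin 2) ℂ) (t : ℂ) :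
    (dehomogenize a).eval t = eval ![t, 1] a := by
  rw [← Polynomial.coe_aeval_eq_eval, ← aeval_complex_eq_eval]
  change (Polynomial.aeval t) (aeval ![Polynomial.X, 1] a) = _
  have := comp_aeval_apply (![Polynomial.X, 1] : Fin 2 → Polynomial ℂ) (Polynomial.aeval t) a
  rw [this]
  congr 2
  funext i; fin_cases i <;> simp

theorem eval_rep_eq {a : MvPolynomial (Fin 2) ℂ} {k : ℕ} (ha : a.IsHomogeneous k) {u : P1}
    (hu : u ≠ infinityPoint) :
    eval u.rep a = u.rep 1 ^ k * (dehomogenize a).eval (affineCoord u) := by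
  conv_lhs => rw [rep_eq_smul hu, eval_smul_of_isHomogeneous ha, ← eval_dehomogenize]

/-- By homogeneity a(x, 1) determines a wherever the second coordinate is nonzero; multiplying by
that coordinate takes care of the rest. -/
theorem dehomogenize_ne_zero {a : MvPolynomial (Fin 2) ℂ} {k : ℕ} (ha : a.IsHomogeneous k)
    (h0 : a ≠ 0) : dehomogenize a ≠ 0 := by
  intro hp0
  have : a * X 1 = 0 := by
    refine MvPolynomial.funext fun x => ?_
    rw [map_mul, eval_X, map_zero]
    by_cases hx : x 1 = 0
    · rw [hx, mul_zero]
    · have h1 : x = x 1 • ![x 0 / x 1, 1] := by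
        ext i; fin_cases i
        · simp; field_simp
        · simp
      rw [h1, eval_smul_of_isHomogeneous ha, ← eval_dehomogenize, hp0]
      simp
  rcases mul_eq_zero.mp this with h | h
  · exact h0 h
  · exact X_ne_zero _ h

theorem finite_zeros_of_isHomogeneous {a : MvPolynomial (Fin 2) ℂ} {k : ℕ} (ha : a.IsHomogeneous k)
    (h0 : a ≠ 0) : {u : P1 | eval u.rep a = 0}.Finite := by
  have hfin : (insert infinityPoint
      (affinePoint '' {t | (dehomogenize a).eval t = 0})).Finite :=
    ((Polynomial.finite_setOfPred_isRoot (dehomogenize_ne_zero ha h0)).image _).insert _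
  refine hfin.subset fun u hu => ?_
  simp only [Set.mem_ofPred_eq] at hu
  by_cases h1 : u = infinityPoint
  · exact Or.inl h1
  · right
    refine ⟨affineCoord u, ?_, affinePoint_affineCoord h1⟩
    rw [eval_rep_eq ha h1, mul_eq_zero] at hu
    simpa [rep_one_ne_zero h1] using hu

instance : Infinite P1 := Infinite.of_injective _ affinePoint_injective

end
end CrossRatio

namespace CrossRatio
noncomputable section
open MvPolynomial
open scoped MatrixGroups

/-! ### Curves that are parametrized by Möbius transformations -/

/-- The irreducible closed sets are the points and the whole space. This computes the dimension of
Möbius curves, since the Zariski topology of ℙ¹ is the cofinite one. -/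
theorem topologicalKrullDim_cofiniteTopology (X : Type*) [Infinite X] :
    topologicalKrullDim (CofiniteTopology X) = 1 := by
  have : Infinite (CofiniteTopology X) := Infinite.of_injective _ (CofiniteTopology.of).injective
  apply le_antisymm
  · rw [topologicalKrullDim, Order.krullDim_le_one_iff]
    intro Z
    rcases CofiniteTopology.isClosed_iff.mp Z.isClosed with h | h
    · right
      intro Z' _ x _
      change x ∈ (Z : Set _)
      rw [h]
      trivial
    · left
      intro Z' hZ' x hx
      obtain ⟨y, hy⟩ := Z'.isIrreducible.nonempty
      have hy' : y ∈ (Z : Set _) := hZ' hy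
      have hsub : (Z : Set (CofiniteTopology X)) ⊆ {y} := by
        have h1 := isPreirreducible_iff_isClosed_union_isClosed.mp Z.isIrreducible.2 {y}
          ((Z : Set (CofiniteTopology X)) \ {y}) isClosed_singleton
          (CofiniteTopology.isClosed_iff.mpr (Or.inr (h.subset Set.sdiff_subset)))
          (fun z hz => by by_cases hzy : z = y <;> simp [hzy, hz])
        rcases h1 with h1 | h1
        · exact h1
        · exact absurd rfl (h1 hy').2
      have : x = y := hsub hx
      rw [this]
      exact hy
  · rw [topologicalKrullDim, Order.one_le_krullDim_iff]
    let x : CofiniteTopology X := Classical.arbitrary _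
    refine ⟨⟨{x}, isIrreducible_singleton, isClosed_singleton⟩,
      ⟨Set.univ, IrreducibleSpace.isIrreducible_univ _, isClosed_univ⟩, ?_⟩
    obtain ⟨y, hy⟩ := exists_ne x
    refine ⟨fun _ _ => trivial, fun h => hy ?_⟩
    exact h (show y ∈ Set.univ from trivial)

section Moebius

variable {S : Type*}

/-- The point with parameter `u` of the curve that is parametrized by the transformations `A`. -/
def moebiusMap (A : S → GL (Fin 2) ℂ) (u : P1) : P1Pow S := fun s => A s • u

/-- The curve in `(ℙ¹)^S` that is parametrized by a family of Möbius transformations. -/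
def moebiusCurve (A : S → GL (Fin 2) ℂ) : Set (P1Pow S) := Set.range (moebiusMap A)

/-- A change of parameter. With `g = (A s)⁻¹` the curve becomes a graph over its `s`-th coordinate.
-/
theorem moebiusCurve_mul_right (A : S → GL (Fin 2) ℂ) (g : GL (Fin 2) ℂ) :
    moebiusCurve (fun s => A s * g) = moebiusCurve A := by
  have : moebiusMap (fun s => A s * g) = moebiusMap A ∘ (g • ·) := by
    funext u s
    exact mul_smul (A s) g u
  rw [moebiusCurve, this, Set.range_comp, (MulAction.surjective g).range_eq, Set.image_univ]
  rfl

theorem mem_moebiusCurve_iff {A : S → GL (Fin 2) ℂ} {s : S} (hs : A s = 1) {P : P1Pow S} :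
    P ∈ moebiusCurve A ↔ ∀ s', P s' = A s' • P s := by
  constructor
  · rintro ⟨u, rfl⟩ s'
    simp [moebiusMap, hs]
  · intro h
    exact ⟨P s, funext fun s' => (h s').symm⟩

theorem isCoords_moebiusMap (A : S → GL (Fin 2) ℂ) (u : P1) :
    IsCoords (moebiusMap A u) fun i => (A i.1 • u.rep) i.2 := by
  refine isCoords_of_mk (w := fun s => A s • u.rep)
    (fun s => (smul_ne_zero_iff_ne (A s)).mpr u.rep_nonzero) fun s => ?_
  rw [← Projectivization.smul_mk (A s) u.rep_nonzero, u.mk_rep]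
  rfl

/-- The pullback of a form under a family of linear transformations. -/
def pullback (A : S → GL (Fin 2) ℂ) (F : MvPolynomial (S × Fin 2) ℂ) : MvPolynomial (Fin 2) ℂ :=
  aeval (fun i : S × Fin 2 => C ((A i.1).val i.2 0) * X 0 + C ((A i.1).val i.2 1) * X 1) F

theorem eval_pullback (A : S → GL (Fin 2) ℂ) (F : MvPolynomial (S × Fin 2) ℂ) (x : Fin 2 → ℂ) :
    eval x (pullback A F) = eval (fun i => (A i.1 • x) i.2) F := by
  rw [pullback, ← aeval_complex_eq_eval, ← aeval_complex_eq_eval, comp_aeval_apply]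
  congr 2
  funext i
  change _ = (A i.1).val.mulVec x i.2
  simp [Matrix.mulVec, dotProduct, Fin.sum_univ_two]

theorem isHomogeneous_pullback (A : S → GL (Fin 2) ℂ) {F : MvPolynomial (S × Fin 2) ℂ}
    {d : S →₀ ℕ} (hF : IsMultihomogeneous F d) : (pullback A F).IsHomogeneous d.degree := by
  have := hF.isHomogeneous.aeval (n := 1) (τ := Fin 2)
    (fun i : S × Fin 2 => C ((A i.1).val i.2 0) * X 0 + C ((A i.1).val i.2 1) * X 1)
    (fun i => (isHomogeneous_C_mul_X _ _).add (isHomogeneous_C_mul_X _ _))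
  rwa [one_mul] at this

theorem evalAt_moebiusMap_eq_zero_iff (A : S → GL (Fin 2) ℂ) {F : MvPolynomial (S × Fin 2) ℂ}
    {d : S →₀ ℕ} (hF : IsMultihomogeneous F d) (u : P1) :
    (moebiusMap A u).evalAt F = 0 ↔ eval u.rep (pullback A F) = 0 := by
  rw [(isCoords_moebiusMap A u).evalAt_eq_zero_iff hF, eval_pullback]

/-- A nonzero binary form has only finitely many zeros on ℙ¹. -/
theorem pullback_eq_zero {A : S → GL (Fin 2) ℂ} {F : MvPolynomial (S × Fin 2) ℂ}
    (hF : F ∈ vanishingForms (moebiusCurve A)) : pullback A F = 0 := by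
  obtain ⟨⟨d, hd⟩, h⟩ := hF
  by_contra h0
  refine Set.infinite_univ ((finite_zeros_of_isHomogeneous (isHomogeneous_pullback A hd) h0).subset
    fun u _ => ?_)
  exact (evalAt_moebiusMap_eq_zero_iff A hd u).mp (h _ ⟨u, rfl⟩)

theorem continuous_moebiusMap (A : S → GL (Fin 2) ℂ) :
    Continuous fun u : CofiniteTopology P1 => moebiusMap A (CofiniteTopology.of.symm u) := by
  refine continuous_generateFrom_iff.mpr ?_
  rintro _ ⟨F, d, hF, rfl⟩
  rw [CofiniteTopology.isOpen_iff]
  rintro ⟨u, hu⟩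
  have h0 : pullback A F ≠ 0 := by
    intro h0
    apply hu
    rw [evalAt_moebiusMap_eq_zero_iff A hF, h0, map_zero]
  refine ((finite_zeros_of_isHomogeneous (isHomogeneous_pullback A hF) h0).image
    CofiniteTopology.of).subset fun v hv => ?_
  simp only [Set.mem_compl_iff, Set.mem_preimage, Set.mem_ofPred_eq, not_not] at hv
  exact ⟨CofiniteTopology.of.symm v, (evalAt_moebiusMap_eq_zero_iff A hF _).mp hv, by simp⟩

theorem isClosed_setOf_eq_smul (s s' : S) (g : GL (Fin 2) ℂ) :
    IsClosed {P : P1Pow S | P s = g • P s'} := by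
  refine (congrArg IsClosed (Set.ext fun P => ?_)).mpr
    (isClosed_evalAt_eq_zero (isMultihomogeneous_bracketForm s s' g.val))
  rw [Set.mem_ofPred_eq, Set.mem_ofPred_eq, P1Pow.evalAt, eval_bracketForm]
  have h1 := bracket_eq_zero_iff (P s).rep_nonzero
    ((smul_ne_zero_iff_ne g).mpr (P s').rep_nonzero)
  rw [← Projectivization.smul_mk g (P s').rep_nonzero, (P s).mk_rep, (P s').mk_rep] at h1
  exact h1.symm

theorem isClosed_setOf_apply_eq (s : S) (x : P1) : IsClosed {P : P1Pow S | P s = x} := by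
  let q := x.rep
  have hF : IsMultihomogeneous (C (q 1) * X (s, 0) - C (q 0) * X (s, 1)) (Finsupp.single s 1) :=
    (IsWeightedHomogeneous.C_mul (isMultihomogeneous_X (s, 0)) _).sub
      (IsWeightedHomogeneous.C_mul (isMultihomogeneous_X (s, 1)) _)
  refine (congrArg IsClosed (Set.ext fun P => ?_)).mpr (isClosed_evalAt_eq_zero hF)
  rw [Set.mem_ofPred_eq, Set.mem_ofPred_eq, ← bracket_rep_eq_zero_iff, P1Pow.evalAt]
  simp [P1Pow.coords, bracket, q, mul_comm]

theorem isClosed_singleton_P1Pow (Q : P1Pow S) : IsClosed ({Q} : Set (P1Pow S)) := by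
  have h : ({Q} : Set (P1Pow S)) = ⋂ s, {P : P1Pow S | P s = Q s} := by
    ext P
    simp only [Set.mem_singleton_iff, Set.mem_iInter, Set.mem_ofPred_eq]
    exact funext_iff
  rw [h]
  exact isClosed_iInter fun s => isClosed_setOf_apply_eq s (Q s)

/-- As a graph over one coordinate, the curve is cut out by bracket forms. -/
theorem isClosed_moebiusCurve [Nonempty S] (A : S → GL (Fin 2) ℂ) : IsClosed (moebiusCurve A) := by
  let s : S := Classical.arbitrary S
  rw [← moebiusCurve_mul_right A (A s)⁻¹]
  have : moebiusCurve (fun s' => A s' * (A s)⁻¹) =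
      ⋂ s', {P : P1Pow S | P s' = (A s' * (A s)⁻¹) • P s} := by
    ext P
    rw [mem_moebiusCurve_iff (s := s) (mul_inv_cancel _)]
    simp
  rw [this]
  exact isClosed_iInter fun s' => isClosed_setOf_eq_smul _ _ _

theorem moebiusMap_injective [Nonempty S] (A : S → GL (Fin 2) ℂ) :
    Function.Injective (moebiusMap A) := fun _ _ h =>
  MulAction.injective (A (Classical.arbitrary S)) (congrFun h (Classical.arbitrary S))

theorem isClosedEmbedding_moebiusMap [Nonempty S] (A : S → GL (Fin 2) ℂ) :
    Topology.IsClosedEmbedding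
      fun u : CofiniteTopology P1 => moebiusMap A (CofiniteTopology.of.symm u) := by
  refine .of_continuous_injective_isClosedMap (continuous_moebiusMap A)
    ((moebiusMap_injective A).comp CofiniteTopology.of.symm.injective) fun Z hZ => ?_
  rcases CofiniteTopology.isClosed_iff.mp hZ with rfl | h
  · rw [Set.image_univ]
    have := CofiniteTopology.of.symm.surjective.range_comp (moebiusMap A)
    exact (congrArg IsClosed this).mpr (isClosed_moebiusCurve A)
  · rw [← Set.biUnion_of_singleton ((fun u : CofiniteTopology P1 => moebiusMap A
      (CofiniteTopology.of.symm u)) '' Z)]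
    exact (h.image _).isClosed_biUnion fun Q _ => isClosed_singleton_P1Pow Q

theorem range_moebiusMap (A : S → GL (Fin 2) ℂ) :
    Set.range (fun u : CofiniteTopology P1 => moebiusMap A (CofiniteTopology.of.symm u)) =
      moebiusCurve A :=
  CofiniteTopology.of.symm.surjective.range_comp (moebiusMap A)

theorem isIrreducible_moebiusCurve (A : S → GL (Fin 2) ℂ) : IsIrreducible (moebiusCurve A) := by
  rw [← range_moebiusMap, ← Set.image_univ]
  exact (IrreducibleSpace.isIrreducible_univ _).image _ (continuous_moebiusMap A).continuousOn

theorem topologicalKrullDim_moebiusCurve [Nonempty S] (A : S → GL (Fin 2) ℂ) :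
    topologicalKrullDim (moebiusCurve A) = 1 := by
  rw [← topologicalKrullDim_cofiniteTopology P1, ← range_moebiusMap]
  exact ((isClosedEmbedding_moebiusMap A).isEmbedding.toHomeomorph.isHomeomorph
    |>.topologicalKrullDim_eq _).symm

/-- A closed subset of a Möbius curve is finite or the whole curve. -/
theorem eq_moebiusCurve_of_subset {A : S → GL (Fin 2) ℂ} {Z : Set (P1Pow S)} (hZ : IsClosed Z)
    (hinf : Z.Infinite) (hsub : Z ⊆ moebiusCurve A) : Z = moebiusCurve A := by
  have h := CofiniteTopology.isClosed_iff.mp (hZ.preimage (continuous_moebiusMap A))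
  have himg := Set.image_preimage_eq_of_subset ((range_moebiusMap A).symm ▸ hsub)
  rcases h with h | h
  · rw [h, Set.image_univ, range_moebiusMap] at himg
    exact himg.symm
  · exact absurd (himg ▸ h.image _) hinf

/-- Once the parameter is the `s`-th coordinate itself, F/G is the quotient of the two pullbacks. -/
theorem projectionHasDegreeOne_moebiusCurve (A : S → GL (Fin 2) ℂ) (s : S) :
    ProjectionHasDegreeOne (moebiusCurve A) s := by
  rw [← moebiusCurve_mul_right A (A s)⁻¹]
  set B : S → GL (Fin 2) ℂ := fun s' => A s' * (A s)⁻¹ with hB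
  have hs : B s = 1 := mul_inv_cancel _
  have hproj : ∀ u, moebiusMap B u s = u := fun u => by simp [moebiusMap, hs]
  constructor
  · rw [moebiusCurve, ← Set.range_comp]
    have : (fun P : P1Pow S => P s) ∘ moebiusMap B = id := funext hproj
    rw [this, Set.range_id]
    exact Set.infinite_univ
  · rintro F G d hF hG ⟨_, ⟨u, rfl⟩, hu⟩
    refine ⟨pullback B F, pullback B G, d.degree, isHomogeneous_pullback B hF,
      isHomogeneous_pullback B hG, ?_, ?_⟩
    · intro h0
      apply hu
      rw [evalAt_moebiusMap_eq_zero_iff B hG, h0, map_zero]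
    · rintro _ ⟨v, rfl⟩
      obtain ⟨c, -, hc⟩ := (isCoords_moebiusMap B v).exists_evalAt
      rw [hc F d hF, hc G d hG, hproj, eval_pullback, eval_pullback]
      ring

end Moebius

end
end CrossRatio

namespace CrossRatio
noncomputable section
open MvPolynomial
open scoped MatrixGroups

/-! ### Tangent spaces of Möbius curves -/

theorem derivative_aeval_eq_sum {σ : Type*} [Fintype σ] (γ : σ → Polynomial ℂ)
    (F : MvPolynomial σ ℂ) :
    Polynomial.derivative (aeval γ F) =
      ∑ i, aeval γ (pderiv i F) * Polynomial.derivative (γ i) := by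
  classical
  induction F using MvPolynomial.induction_on with
  | C a => simp [Polynomial.algebraMap_eq]
  | add p q hp hq => simp [hp, hq, add_mul, Finset.sum_add_distrib]
  | mul_X p j hp =>
    have h1 : ∀ i, aeval γ (pderiv i (p * X j)) * Polynomial.derivative (γ i) =
        aeval γ (pderiv i p) * Polynomial.derivative (γ i) * γ j +
          if i = j then aeval γ p * Polynomial.derivative (γ j) else 0 := by
      intro i
      rw [pderiv_mul, map_add, map_mul, map_mul, aeval_X, pderiv_X]
      by_cases hij : i = j
      · subst hij
        rw [Pi.single_eq_same, map_one, if_pos rfl]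
        ring
      · rw [Pi.single_eq_of_ne (Ne.symm hij), map_zero, if_neg hij]
        ring
    rw [Finset.sum_congr rfl fun i _ => h1 i, Finset.sum_add_distrib, ← Finset.sum_mul, ← hp,
      Finset.sum_ite_eq' Finset.univ j, if_pos (Finset.mem_univ j), map_mul, aeval_X,
      Polynomial.derivative_mul]

theorem eval_aeval_polynomial {σ : Type*} (γ : σ → Polynomial ℂ) (F : MvPolynomial σ ℂ) (t : ℂ) :
    (aeval γ F).eval t = eval (fun i => (γ i).eval t) F := by
  rw [← Polynomial.coe_aeval_eq_eval, ← aeval_complex_eq_eval]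
  change (Polynomial.aeval t) (aeval γ F) = _
  rw [comp_aeval_apply]

variable {S : Type*} [Fintype S]

/-- The differential of a form is its derivative along any curve with the given tangent vector. -/
theorem differential_apply_eq (P : P1Pow S) (F : MvPolynomial (S × Fin 2) ℂ)
    {γ : S × Fin 2 → Polynomial ℂ} (h0 : ∀ i, (γ i).eval 0 = P.coords i) {w : S × Fin 2 → ℂ}
    (h1 : ∀ i, (Polynomial.derivative (γ i)).eval 0 = w i) :
    differential P F w = (Polynomial.derivative (aeval γ F)).eval 0 := by
  rw [derivative_aeval_eq_sum, Polynomial.eval_finsetSum, differential, LinearMap.sum_apply]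
  refine Finset.sum_congr rfl fun i _ => ?_
  rw [Polynomial.eval_mul, h1, eval_aeval_polynomial, LinearMap.smul_apply, LinearMap.proj_apply,
    smul_eq_mul, P1Pow.evalAt]
  simp only [h0]

theorem differential_bracketForm (P : P1Pow S) (s s' : S) (B : Matrix (Fin 2) (Fin 2) ℂ)
    (w : S × Fin 2 → ℂ) : differential P (bracketForm s s' B) w =
      bracket (fun i => w (s, i)) (B.mulVec fun i => P.coords (s', i)) +
      bracket (fun i => P.coords (s, i)) (B.mulVec fun i => w (s', i)) := by
  rw [differential_apply_eq P _ (γ := fun i => Polynomial.C (P.coords i) +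
    Polynomial.X * Polynomial.C (w i)) (by simp) (by simp)]
  simp [bracketForm, bracket, Matrix.mulVec, dotProduct, Fin.sum_univ_two,
    Polynomial.algebraMap_eq]
  ring

theorem exists_eq_smul_of_bracket_eq_zero {p q : Fin 2 → ℂ} (hq : q ≠ 0) (h : bracket p q = 0) :
    ∃ c : ℂ, p = c • q := by
  by_cases hp : p = 0
  · exact ⟨0, by simp [hp]⟩
  · obtain ⟨c, hc⟩ := (Projectivization.mk_eq_mk_iff' ℂ p q hp hq).mp
      ((bracket_eq_zero_iff hp hq).mp h)
    exact ⟨c, hc.symm⟩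

/-- The tangent space of the multi-cone is parametrized by a variation ξ of the parameter vector in
ℂ² and by independent rescalings η of the coordinates in the other factors: 2 + (|S| - 1)
dimensions. -/
theorem finrank_coneTangentSpace_moebiusCurve {A : S → GL (Fin 2) ℂ} {s₀ : S} (hs₀ : A s₀ = 1)
    {P : P1Pow S} (hP : P ∈ moebiusCurve A) :
    Module.finrank ℂ (coneTangentSpace (moebiusCurve A) P) = Fintype.card S + 1 := by
  classical
  let p : S → Fin 2 → ℂ := fun s => (P s).rep
  have hp : ∀ s, p s ≠ 0 := fun s => (P s).rep_nonzero
  have hκ : ∀ s, ∃ κ : ℂ, κ ≠ 0 ∧ p s = κ • (A s • p s₀) := by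
    intro s
    have h1 := (mem_moebiusCurve_iff hs₀).mp hP s
    have h2 : P s = Projectivization.mk ℂ (A s • p s₀)
        ((smul_ne_zero_iff_ne (A s)).mpr (hp s₀)) := by
      rw [← Projectivization.smul_mk (A s) (hp s₀), (P s₀).mk_rep, h1]
    obtain ⟨a, ha⟩ := Projectivization.exists_smul_eq_mk_rep ℂ (A s • p s₀)
        ((smul_ne_zero_iff_ne (A s)).mpr (hp s₀))
    exact ⟨a, a.ne_zero, by rw [← h2] at ha; exact ha.symm⟩
  choose κ hκ0 hκ using hκ
  have hκ1 : κ s₀ = 1 := by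
    have h1 := hκ s₀
    rw [hs₀, one_smul] at h1
    have h2 : (κ s₀ - 1) • p s₀ = 0 := by rw [sub_smul, one_smul, ← h1, sub_self]
    rcases smul_eq_zero.mp h2 with h | h
    · exact sub_eq_zero.mp h
    · exact absurd h (hp s₀)
  -- No rescaling at `s₀`: together with the other rescalings, a ξ proportional to `p s₀` already
  -- accounts for it.
  let η' : ({s : S // s ≠ s₀} → ℂ) → S → ℂ := fun η s => if h : s ≠ s₀ then η ⟨s, h⟩ else 0
  let L : ((Fin 2 → ℂ) × ({s : S // s ≠ s₀} → ℂ)) →ₗ[ℂ] (S × Fin 2 → ℂ) :=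
    { toFun := fun x i => κ i.1 * (A i.1).val.mulVec x.1 i.2 + η' x.2 i.1 * p i.1 i.2
      map_add' := by
        intro x y
        funext i
        simp only [Prod.fst_add, Prod.snd_add, Matrix.mulVec_add, Pi.add_apply, η']
        split_ifs <;> ring
      map_smul' := by
        intro c x
        funext i
        simp only [Prod.smul_fst, Prod.smul_snd, Matrix.mulVec_smul, Pi.smul_apply, smul_eq_mul,
          RingHom.id_apply, η']
        split_ifs <;> ring }
  have hL : ∀ x i, L x i = κ i.1 * (A i.1).val.mulVec x.1 i.2 + η' x.2 i.1 * p i.1 i.2 :=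
    fun _ _ => rfl
  have hA₀ : (A s₀).val = 1 := by rw [hs₀]; rfl
  have hL₀ : ∀ x j, L x (s₀, j) = x.1 j := by
    intro x j
    simp [hL, hκ1, hA₀, η']
  have hinj : Function.Injective L := by
    rw [injective_iff_map_eq_zero]
    rintro ⟨ξ, η⟩ h
    have hξ : ξ = 0 := by
      funext j
      exact (hL₀ (ξ, η) j).symm.trans (congrFun h (s₀, j))
    subst hξ
    have hη : η = 0 := by
      funext s
      obtain ⟨j, hj⟩ := Function.ne_iff.mp (hp s)
      have h1 := congrFun h (s.1, j)
      rw [hL] at h1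
      have hj' : p s j ≠ 0 := hj
      simpa [η', s.2, hj'] using h1
    rw [hη]
    rfl
  have hrange : coneTangentSpace (moebiusCurve A) P = LinearMap.range L := by
    apply le_antisymm
    · intro w hw
      simp only [coneTangentSpace, Submodule.mem_iInf, LinearMap.mem_ker] at hw
      -- The differentials of the equations of the graph force the `s`-component of `w` to be κ A
      -- applied to its `s₀`-component, modulo `p s`.
      have hvan : ∀ s, bracketForm s s₀ (A s).val ∈ vanishingForms (moebiusCurve A) := by
        intro s
        refine ⟨⟨_, isMultihomogeneous_bracketForm s s₀ _⟩, ?_⟩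
        rintro _ ⟨u, rfl⟩
        rw [(isCoords_moebiusMap A u).evalAt_eq_zero_iff (isMultihomogeneous_bracketForm s s₀ _),
          eval_bracketForm]
        simp only [hs₀, one_smul]
        exact bracket_self _
      have hs : ∀ s, ∃ c : ℂ, (fun i => w (s, i)) -
          κ s • (A s).val.mulVec (fun i => w (s₀, i)) = c • p s := by
        intro s
        refine exists_eq_smul_of_bracket_eq_zero (hp s) ?_
        have h1 := hw _ (hvan s)
        rw [differential_bracketForm] at h1
        have h2 : p s = κ s • (A s).val.mulVec (p s₀) := hκ s
        change bracket _ ((A s).val.mulVec (p s₀)) + bracket (p s) _ = 0 at h1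
        rw [h2] at h1 ⊢
        simp only [bracket, Pi.sub_apply, Pi.smul_apply, smul_eq_mul] at h1 ⊢
        linear_combination κ s * h1
      choose c hc using hs
      refine ⟨(fun i => w (s₀, i), fun s => c s.1), ?_⟩
      funext ⟨s, j⟩
      by_cases h : s = s₀
      · subst h
        rw [hL₀]
      · have h1 := congrFun (hc s) j
        simp only [Pi.sub_apply, Pi.smul_apply, smul_eq_mul] at h1
        rw [hL]
        simp only [η', ne_eq, h, not_false_eq_true, dif_pos]
        rw [← h1]
        ring
    · rintro _ ⟨⟨ξ, η⟩, rfl⟩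
      simp only [coneTangentSpace, Submodule.mem_iInf, LinearMap.mem_ker]
      intro F hF
      -- A path on which forms vanishing on the curve are identically zero, with the given tangent
      -- vector at 0.
      let γ : S × Fin 2 → Polynomial ℂ := fun i =>
        (1 + Polynomial.X * Polynomial.C (η' η i.1)) * Polynomial.C (κ i.1) *
          (Polynomial.C ((A i.1).val.mulVec (p s₀) i.2) +
            Polynomial.X * Polynomial.C ((A i.1).val.mulVec ξ i.2))
      have hpc : ∀ i : S × Fin 2, P.coords i = κ i.1 * (A i.1).val.mulVec (p s₀) i.2 := fun i =>
        congrFun (hκ i.1) i.2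
      rw [differential_apply_eq P F (γ := γ)]
      · have hzero : aeval γ F = 0 := by
          refine Polynomial.funext fun t => ?_
          rw [eval_aeval_polynomial, Polynomial.eval_zero]
          obtain ⟨⟨d, hd⟩, -⟩ := id hF
          have h1 : (fun i => (γ i).eval t) = fun i : S × Fin 2 =>
              ((1 + t * η' η i.1) * κ i.1) * (A i.1 • (p s₀ + t • ξ)) i.2 := by
            funext i
            change _ = _ * (A i.1).val.mulVec (p s₀ + t • ξ) i.2
            rw [Matrix.mulVec_add, Matrix.mulVec_smul]
            simp only [γ, Polynomial.eval_mul, Polynomial.eval_add, Polynomial.eval_one,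
              Polynomial.eval_X, Polynomial.eval_C, Pi.add_apply, Pi.smul_apply, smul_eq_mul]
          rw [h1, hd.eval_smul (fun s => (1 + t * η' η s) * κ s), ← eval_pullback,
            pullback_eq_zero hF, map_zero, mul_zero]
        rw [hzero]
        simp
      · intro i
        rw [hpc]
        simp [γ]
      · intro i
        rw [hL]
        have : p i.1 i.2 = P.coords i := rfl
        rw [this, hpc]
        simp [γ]
        ring
  rw [hrange, LinearMap.finrank_range_of_inj hinj]
  simp [Fintype.card_subtype_compl]
  have : 0 < Fintype.card S := Fintype.card_pos_iff.mpr ⟨s₀⟩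
  omega

theorem moebiusCurve_mem_curveModuli [Nonempty S] (A : S → GL (Fin 2) ℂ) :
    moebiusCurve A ∈ curveModuli S := by
  refine ⟨⟨isClosed_moebiusCurve A, isIrreducible_moebiusCurve A,
    topologicalKrullDim_moebiusCurve A, ?_⟩, projectionHasDegreeOne_moebiusCurve A⟩
  let s : S := Classical.arbitrary S
  rw [← moebiusCurve_mul_right A (A s)⁻¹]
  exact fun P hP => finrank_coneTangentSpace_moebiusCurve (s₀ := s) (mul_inv_cancel _) hP

end
end CrossRatio

namespace CrossRatio
noncomputable section
open scoped MatrixGroups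

/-! ### Every curve of multidegree `(1, …, 1)` is a Möbius curve -/

open Polynomial IntermediateField in
/-- A rational function with a rational inverse has degree one. -/
theorem exists_linear_fractional {α β α' β' : ℂ[X]} (hβ : β ≠ 0) (hβ' : β' ≠ 0) {E : Set (ℂ × ℂ)}
    (hE : (Prod.fst '' E).Infinite) (h₁ : ∀ p ∈ E, p.2 * β.eval p.1 = α.eval p.1)
    (h₂ : ∀ p ∈ E, p.1 * β'.eval p.2 = α'.eval p.2)
    (hconst : ∀ c, ∃ p ∈ E, β.eval p.1 ≠ 0 ∧ p.2 ≠ c) :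
    ∃ a b c d : ℂ, a * d - b * c ≠ 0 ∧
      ∀ p ∈ E, β.eval p.1 ≠ 0 → p.2 * (c * p.1 + d) = a * p.1 + b := by
  have hinj : Function.Injective (algebraMap ℂ[X] (RatFunc ℂ)) := RatFunc.algebraMap_injective ℂ
  have hβK : algebraMap ℂ[X] (RatFunc ℂ) β ≠ 0 := by rwa [Ne, map_eq_zero_iff _ hinj]
  set f : RatFunc ℂ := algebraMap _ _ α / algebraMap _ _ β with hf
  have hfnd : α * f.denom = β * f.num := by
    apply hinj
    have h := f.num_div_denom
    have hd : algebraMap ℂ[X] (RatFunc ℂ) f.denom ≠ 0 := by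
      rw [Ne, map_eq_zero_iff _ hinj]; exact f.denom_ne_zero
    conv_rhs at h => rw [hf]
    rw [div_eq_div_iff hd hβK] at h
    rw [map_mul, map_mul, ← h, mul_comm]
  have hval : ∀ p ∈ E, β.eval p.1 ≠ 0 → p.2 * f.denom.eval p.1 = f.num.eval p.1 := by
    intro p hp hb
    have h := congrArg (Polynomial.eval p.1) hfnd
    rw [Polynomial.eval_mul, Polynomial.eval_mul, ← h₁ p hp] at h
    apply mul_left_cancel₀ hb
    rw [← h]
    ring
  have hnc : ¬ ∃ c, f = RatFunc.C c := by
    rintro ⟨c, hc⟩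
    obtain ⟨p, hp, hb, hne⟩ := hconst c
    have h := hval p hp hb
    rw [hc, RatFunc.denom_C, RatFunc.num_C, Polynomial.eval_one, Polynomial.eval_C, mul_one] at h
    exact hne h
  have htr := f.transcendental_of_ne_C hnc
  have hβf : aeval f β' ≠ 0 := fun h => htr ⟨β', hβ', h⟩
  -- Evaluated at points of `E` this says that the second map inverts the first. It holds at
  -- infinitely many first coordinates, hence identically, and so X lies in ℂ(f).
  have hrel : RatFunc.X * aeval f β' - aeval f α' = 0 := by
    set r := RatFunc.X * aeval f β' - aeval f α' with hr
    rw [← RatFunc.num_eq_zero_iff]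
    by_contra hnum
    have hfin : (Prod.fst '' E).Finite := by
      refine ((finite_setOfPred_isRoot hβ).union (finite_setOfPred_isRoot hnum)).subset ?_
      rintro _ ⟨p, hp, rfl⟩
      by_cases hb : β.eval p.1 = 0
      · exact Or.inl hb
      right
      obtain ⟨O, ψ, hO⟩ := exists_extension_to_localRing (F := ℂ) (A := ℂ[X]) (K := RatFunc ℂ)
        hinj (aeval p.1)
      simp only [coe_aeval_eq_eval] at hO
      obtain ⟨hfO, hψf⟩ := hO α β f hb (div_mul_cancel₀ _ hβK)
      obtain ⟨hXO, hψX⟩ := hO Polynomial.X 1 RatFunc.X (by simp) (by simp [RatFunc.algebraMap_X])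
      rw [Polynomial.eval_one, mul_one, Polynomial.eval_X] at hψX
      have hψf' : ψ ⟨f, hfO⟩ = p.2 := by
        rw [← h₁ p hp] at hψf
        exact mul_right_cancel₀ hb hψf
      have hpoly : ∀ q : ℂ[X], ∃ h : aeval f q ∈ O, ψ ⟨aeval f q, h⟩ = q.eval p.2 := by
        intro q
        have h1 : aeval f q = O.val (aeval ⟨f, hfO⟩ q) := (aeval_algHom_apply O.val _ q).symm ▸ rfl
        refine ⟨h1 ▸ SetLike.coe_mem _, ?_⟩
        have h2 : (⟨aeval f q, h1 ▸ SetLike.coe_mem _⟩ : O) = aeval ⟨f, hfO⟩ q := Subtype.ext h1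
        rw [h2, ← aeval_algHom_apply, hψf', coe_aeval_eq_eval]
      obtain ⟨hbO, hψb⟩ := hpoly β'
      obtain ⟨haO, hψa⟩ := hpoly α'
      have hrO : r ∈ O := O.sub_mem (O.mul_mem hXO hbO) haO
      have hψr : ψ ⟨r, hrO⟩ = 0 := by
        have : (⟨r, hrO⟩ : O) = ⟨_, hXO⟩ * ⟨_, hbO⟩ - ⟨_, haO⟩ := rfl
        rw [this, map_sub, map_mul, hψX, hψb, hψa, h₂ p hp, sub_self]
      have hpO : ∀ q : ℂ[X], ∃ h : algebraMap _ (RatFunc ℂ) q ∈ O, ψ ⟨_, h⟩ = q.eval p.1 := by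
        intro q
        obtain ⟨h1, h2⟩ := hO q 1 (algebraMap _ _ q) (by simp) (by simp)
        rw [Polynomial.eval_one, mul_one] at h2
        exact ⟨h1, h2⟩
      have hd : algebraMap ℂ[X] (RatFunc ℂ) r.denom ≠ 0 := by
        rw [Ne, map_eq_zero_iff _ hinj]; exact r.denom_ne_zero
      have h3 : (⟨_, (hpO r.num).1⟩ : O) = ⟨r, hrO⟩ * ⟨_, (hpO r.denom).1⟩ := by
        refine Subtype.ext ?_
        change _ = r * _
        rw [← div_eq_iff hd]
        exact r.num_div_denom
      change r.num.eval p.1 = 0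
      rw [← (hpO r.num).2, h3, map_mul, hψr, zero_mul]
    exact hE hfin
  have htop : ℂ⟮f⟯ = ⊤ := by
    rw [eq_top_iff, ← RatFunc.adjoin_X, adjoin_simple_le_iff]
    have hX : RatFunc.X = aeval f α' / aeval f β' := by
      rw [eq_div_iff hβf]
      exact sub_eq_zero.mp hrel
    have hmem : ∀ q : ℂ[X], aeval f q ∈ ℂ⟮f⟯ := fun q =>
      algebra_adjoin_le_adjoin ℂ {f} (aeval_mem_adjoin_singleton ℂ f)
    rw [hX]
    exact div_mem (hmem _) (hmem _)
  -- The degree of ℂ(X) over ℂ(f) is the larger of the degrees of numerator and denominator.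
  have hdeg : max f.num.natDegree f.denom.natDegree = 1 := by
    rw [← RatFunc.finrank_eq_max_natDegree, htop, IntermediateField.finrank_top]
  have hn := Polynomial.eq_X_add_C_of_natDegree_le_one ((le_max_left _ _).trans hdeg.le)
  have hd := Polynomial.eq_X_add_C_of_natDegree_le_one ((le_max_right _ _).trans hdeg.le)
  set a := f.num.coeff 1
  set b := f.num.coeff 0
  set c := f.denom.coeff 1
  set d := f.denom.coeff 0
  refine ⟨a, b, c, d, ?_, fun p hp hb => ?_⟩
  · intro hdet
    have hcop := f.isCoprime_num_denom
    -- A vanishing determinant makes numerator and denominator proportional, against their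
    -- coprimality.
    have hlin : Polynomial.C c * f.num = Polynomial.C a * f.denom := by
      have h4 : Polynomial.C (a * d - b * c) = 0 := by rw [hdet, map_zero]
      rw [hn, hd]
      simp only [map_sub, map_mul] at h4
      linear_combination -h4
    have hac : a ≠ 0 ∨ c ≠ 0 := by
      by_contra! h
      have h5 : f.num.natDegree = 0 := by rw [hn, h.1]; simp
      have h6 : f.denom.natDegree = 0 := by rw [hd, h.2]; simp
      rw [h5, h6] at hdeg
      simp at hdeg
    rcases hac with ha | hc
    · have hdvd : f.num ∣ f.denom := by
        refine ⟨Polynomial.C (a⁻¹ * c), ?_⟩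
        rw [map_mul, mul_left_comm, mul_comm f.num, hlin, ← mul_assoc, ← map_mul,
          inv_mul_cancel₀ ha, map_one, one_mul]
      have hu := hcop.isUnit_of_dvd' dvd_rfl hdvd
      have := Polynomial.natDegree_eq_zero_of_isUnit hu
      rw [hn, Polynomial.natDegree_linear ha] at this
      exact one_ne_zero this
    · have hdvd : f.denom ∣ f.num := by
        refine ⟨Polynomial.C (c⁻¹ * a), ?_⟩
        rw [map_mul, mul_left_comm, mul_comm f.denom, ← hlin, ← mul_assoc, ← map_mul,
          inv_mul_cancel₀ hc, map_one, one_mul]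
      have hu := hcop.isUnit_of_dvd' hdvd dvd_rfl
      have := Polynomial.natDegree_eq_zero_of_isUnit hu
      rw [hd, Polynomial.natDegree_linear hc] at this
      exact one_ne_zero this
  · have h := hval p hp hb
    rw [hn, hd] at h
    simpa using h

open MvPolynomial

variable {S : Type*}

theorem isClosed_setOf_apply_mem (s : S) {Z : Set P1} (hZ : Z.Finite) :
    IsClosed {P : P1Pow S | P s ∈ Z} := by
  have : {P : P1Pow S | P s ∈ Z} = ⋃ x ∈ Z, {P : P1Pow S | P s = x} := by ext P; simp
  rw [this]
  exact hZ.isClosed_biUnion fun x _ => isClosed_setOf_apply_eq s x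

/-- An irreducible set with infinite projections that lies in a closed set away from finitely many
values of two coordinates lies in that closed set. -/
theorem subset_of_generic {C : Set (P1Pow S)} (hC : IsIrreducible C) {s s' : S}
    (hs : ((fun P : P1Pow S => P s) '' C).Infinite) (hs' : ((fun P : P1Pow S => P s') '' C).Infinite)
    {Z Z' : Set P1} (hZ : Z.Finite) (hZ' : Z'.Finite) {Y : Set (P1Pow S)} (hY : IsClosed Y)
    (h : ∀ P ∈ C, P s ∉ Z → P s' ∉ Z' → P ∈ Y) : C ⊆ Y := by
  have key := isPreirreducible_iff_isClosed_union_isClosed.mp hC.2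
  rcases key _ _ (isClosed_setOf_apply_mem s hZ) ((isClosed_setOf_apply_mem s' hZ').union hY)
    (fun P hP => by
      by_cases h1 : P s ∈ Z
      · exact Or.inl h1
      by_cases h2 : P s' ∈ Z'
      · exact Or.inr (Or.inl h2)
      exact Or.inr (Or.inr (h P hP h1 h2))) with h1 | h1
  · exact absurd (hZ.subset (Set.image_subset_iff.mpr h1)) hs
  · rcases key _ _ (isClosed_setOf_apply_mem s' hZ') hY h1 with h2 | h2
    · exact absurd (hZ'.subset (Set.image_subset_iff.mpr h2)) hs'
    · exact h2

/-- Degree one at `s`, applied to the rational function given by the affine coordinate at `s'`. Its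
denominator is not identically zero on `C` because the projection to `s'` has infinite image. -/
theorem exists_relation_of_projectionHasDegreeOne {C : Set (P1Pow S)} {s s' : S}
    (hs : ProjectionHasDegreeOne C s) (hs' : ProjectionHasDegreeOne C s') :
    ∃ a b : MvPolynomial (Fin 2) ℂ, ∃ k, a.IsHomogeneous k ∧ b.IsHomogeneous k ∧ b ≠ 0 ∧
      ∀ P ∈ C, P s ≠ infinityPoint → P s' ≠ infinityPoint →
        affineCoord (P s') * (dehomogenize b).eval (affineCoord (P s)) =
          (dehomogenize a).eval (affineCoord (P s)) := by
  have hex : ∃ P ∈ C, P.evalAt (X (s', 1)) ≠ 0 := by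
    by_contra! h
    refine hs'.1 ((Set.finite_singleton infinityPoint).subset ?_)
    rintro _ ⟨P, hP, rfl⟩
    by_contra hne
    have := h P hP
    rw [P1Pow.evalAt, eval_X] at this
    exact rep_one_ne_zero hne this
  obtain ⟨a, b, k, ha, hb, hb0, hab⟩ := hs.2 (X (s', 0)) (X (s', 1)) _ (isMultihomogeneous_X (s', 0))
    (isMultihomogeneous_X (s', 1)) hex
  refine ⟨a, b, k, ha, hb, hb0, fun P hP h1 h2 => ?_⟩
  have h := hab P hP
  rw [P1Pow.evalAt, P1Pow.evalAt, eval_X, eval_X, eval_rep_eq ha h1, eval_rep_eq hb h1] at h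
  change (P s').rep 0 * _ = (P s').rep 1 * _ at h
  have h3 := rep_one_ne_zero h1
  have h4 := rep_one_ne_zero h2
  apply mul_left_cancel₀ (mul_ne_zero h4 (pow_ne_zero k h3))
  have h5 : (P s').rep 1 * affineCoord (P s') = (P s').rep 0 := mul_div_cancel₀ _ h4
  linear_combination h + (P s).rep 1 ^ k * (dehomogenize b).eval (affineCoord (P s)) * h5

/-- The coordinates at `s` and `s'` are rational functions of each other, hence linear fractional on
the affine part; irreducibility spreads the relation over the finitely many excluded values. -/
theorem exists_smul_eq_of_degreeOne {C : Set (P1Pow S)} (hC : IsIrreducible C) {s s' : S}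
    (hs : ProjectionHasDegreeOne C s) (hs' : ProjectionHasDegreeOne C s') :
    ∃ g : GL (Fin 2) ℂ, ∀ P ∈ C, P s' = g • P s := by
  obtain ⟨a, b, k, ha, hb, hb0, hab⟩ := exists_relation_of_projectionHasDegreeOne hs hs'
  obtain ⟨a', b', k', ha', hb', hb0', hab'⟩ := exists_relation_of_projectionHasDegreeOne hs' hs
  let E : Set (ℂ × ℂ) := (fun P : P1Pow S => (affineCoord (P s), affineCoord (P s'))) ''
    {P ∈ C | P s ≠ infinityPoint ∧ P s' ≠ infinityPoint}
  have hβ := dehomogenize_ne_zero hb hb0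
  have hZ : (insert infinityPoint
      (affinePoint '' {t | (dehomogenize b).eval t = 0})).Finite :=
    ((Polynomial.finite_setOfPred_isRoot hβ).image _).insert _
  have hZb : ∀ u : P1, u ∉ (insert infinityPoint
      (affinePoint '' {t | (dehomogenize b).eval t = 0})) → u ≠ infinityPoint ∧
      (dehomogenize b).eval (affineCoord u) ≠ 0 := by
    intro u hu
    have h1 : u ≠ infinityPoint := fun h => hu (Or.inl h)
    exact ⟨h1, fun h => hu (Or.inr ⟨_, h, affinePoint_affineCoord h1⟩)⟩
  have hempty : ∀ {Y : Set (P1Pow S)}, C ⊆ Y → Y.Nonempty := fun h => hC.1.mono h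
  obtain ⟨α, β, γ, δ, hdet, hlin⟩ := exists_linear_fractional (E := E)
    (α := dehomogenize a) (α' := dehomogenize a') hβ (dehomogenize_ne_zero hb' hb0') (by
      intro hfin
      have h1 : ((insert infinityPoint (affinePoint '' (Prod.fst '' E)))).Finite :=
        (hfin.image _).insert _
      refine (Set.not_nonempty_empty (hempty (subset_of_generic hC hs.1 hs'.1 h1
        (Set.finite_singleton infinityPoint) isClosed_empty fun P hP h2 h3 => ?_))).elim
      have h4 : P s ≠ infinityPoint := fun h => h2 (Or.inl h)
      exact h2 (Or.inr ⟨_, ⟨_, ⟨P, ⟨hP, h4, h3⟩, rfl⟩, rfl⟩, affinePoint_affineCoord h4⟩))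
    (by
      rintro _ ⟨P, ⟨hP, h1, h2⟩, rfl⟩
      exact hab P hP h1 h2)
    (by
      rintro _ ⟨P, ⟨hP, h1, h2⟩, rfl⟩
      exact hab' P hP h2 h1)
    (by
      intro c
      by_contra! hcon
      refine (Set.not_nonempty_empty (hempty (subset_of_generic hC hs.1 hs'.1 hZ
        (Set.toFinite {infinityPoint, affinePoint c}) isClosed_empty fun P hP h2 h3 => ?_))).elim
      have h4 := hZb _ h2
      have h5 : P s' ≠ infinityPoint := fun h => h3 (Or.inl h)
      have h6 := hcon _ ⟨P, ⟨hP, h4.1, h5⟩, rfl⟩ h4.2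
      apply h3
      right
      simp only at h6
      rw [Set.mem_singleton_iff, ← h6, affinePoint_affineCoord h5])
  let g : GL (Fin 2) ℂ := Matrix.GeneralLinearGroup.mkOfDetNeZero !![α, β; γ, δ]
    (by rwa [Matrix.det_fin_two_of])
  refine ⟨g, subset_of_generic hC hs.1 hs'.1 hZ (Set.finite_singleton infinityPoint)
    (isClosed_setOf_eq_smul s' s g) fun P hP h2 h3 => ?_⟩
  have h4 := hZb _ h2
  have h5 := hlin _ ⟨P, ⟨hP, h4.1, h3⟩, rfl⟩ h4.2
  simp only at h5
  change P s' = g • P s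
  rw [← affinePoint_affineCoord h4.1, ← affinePoint_affineCoord h3, affinePoint,
    affinePoint, Projectivization.smul_mk, ← bracket_eq_zero_iff]
  change bracket _ ((!![α, β; γ, δ] : Matrix (Fin 2) (Fin 2) ℂ).mulVec _) = 0
  simp [bracket, Matrix.mulVec, dotProduct, Fin.sum_univ_two]
  linear_combination h5

theorem exists_eq_moebiusCurve [Fintype S] [Nonempty S] {C : Set (P1Pow S)}
    (hC : C ∈ curveModuli S) : ∃ A : S → GL (Fin 2) ℂ, C = moebiusCurve A := by
  obtain ⟨hcurve, hdeg⟩ := hC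
  let s : S := Classical.arbitrary S
  choose A hA using fun s' => exists_smul_eq_of_degreeOne hcurve.isIrreducible (hdeg s) (hdeg s')
  refine ⟨A, eq_moebiusCurve_of_subset hcurve.isClosed (fun h => (hdeg s).1 (h.image _)) ?_⟩
  intro P hP
  exact ⟨P s, funext fun s' => (hA s' P hP).symm⟩

end
end CrossRatio

namespace CrossRatio
noncomputable section
open scoped MatrixGroups

/-! ### Cross-ratios of points of the projective line -/

/-- The cross-ratio of four points of `ℙ¹`. -/
def pointCrossRatio (x : Fin 4 → P1) : ℂ :=
  crossRatio (x 0).rep (x 1).rep (x 2).rep (x 3).rep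

theorem pointCrossRatio_mk {p : Fin 4 → Fin 2 → ℂ} (hp : ∀ i, p i ≠ 0) :
    pointCrossRatio (fun i => Projectivization.mk ℂ (p i) (hp i)) =
      crossRatio (p 0) (p 1) (p 2) (p 3) := by
  choose a ha using fun i => Projectivization.exists_smul_eq_mk_rep ℂ (p i) (hp i)
  simp only [pointCrossRatio, ← ha]
  exact crossRatio_smul (a 0).ne_zero (a 1).ne_zero (a 2).ne_zero (a 3).ne_zero _ _ _ _

theorem pointCrossRatio_smul (g : GL (Fin 2) ℂ) (x : Fin 4 → P1) :
    pointCrossRatio (fun i => g • x i) = pointCrossRatio x := by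
  have h1 : (fun i => g • x i) = fun i => Projectivization.mk ℂ (g • (x i).rep)
      ((smul_ne_zero_iff_ne g).mpr (x i).rep_nonzero) := by
    funext i
    rw [← Projectivization.smul_mk g (x i).rep_nonzero, (x i).mk_rep]
  rw [h1, pointCrossRatio_mk]
  have hdet : g.val.det ≠ 0 := ((Matrix.isUnit_iff_isUnit_det _).mp g.isUnit).ne_zero
  exact crossRatio_map (φ := fun p => g • p) hdet (bracket_smul_smul g) _ _ _ _

theorem bracket_rep_ne_zero {x y : P1} (h : x ≠ y) : bracket x.rep y.rep ≠ 0 :=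
  fun h0 => h ((bracket_rep_eq_zero_iff x y).mp h0)

/-- The cross-ratio determines the fourth point. -/
theorem eq_of_pointCrossRatio_eq {x y : Fin 4 → P1} (hx : Function.Injective x)
    (hy : Function.Injective y) (h0 : x 0 = y 0) (h1 : x 1 = y 1) (h2 : x 2 = y 2)
    (h : pointCrossRatio x = pointCrossRatio y) : x 3 = y 3 := by
  have hx' : ∀ i j, i ≠ j → bracket (x i).rep (x j).rep ≠ 0 := fun i j hij =>
    bracket_rep_ne_zero (hx.ne hij)
  have hy' : ∀ i j, i ≠ j → bracket (y i).rep (y j).rep ≠ 0 := fun i j hij =>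
    bracket_rep_ne_zero (hy.ne hij)
  have a1 := hx' 2 0 (by decide)
  have a2 := hx' 2 1 (by decide)
  have a3 := hx' 3 0 (by decide)
  have a4 := hy' 3 0 (by decide)
  have a5 := hx' 0 1 (by decide)
  simp only [pointCrossRatio, crossRatio, ← h0, ← h1, ← h2] at h
  rw [← h0] at a4
  rw [div_eq_div_iff (mul_ne_zero a2 a3) (mul_ne_zero a2 a4)] at h
  rw [← bracket_rep_eq_zero_iff]
  -- The cross-multiplied equation factors in this way by the Plücker relation between brackets.
  have h3 : bracket (x 2).rep (x 0).rep * bracket (x 2).rep (x 1).rep *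
      bracket (x 0).rep (x 1).rep * bracket (x 3).rep (y 3).rep = 0 := by
    simp only [bracket] at h ⊢
    linear_combination -h
  rcases mul_eq_zero.mp h3 with h4 | h4
  · exact absurd h4 (mul_ne_zero (mul_ne_zero a1 a2) a5)
  · exact h4

/-- Möbius transformations act transitively on triples of distinct points. -/
theorem exists_smul_eq_of_three {x y : Fin 3 → P1} (hx : Function.Injective x)
    (hy : Function.Injective y) : ∃ g : GL (Fin 2) ℂ, ∀ i, g • x i = y i := by
  have hx' : ∀ i j, i ≠ j → bracket (x i).rep (x j).rep ≠ 0 := fun i j hij =>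
    bracket_rep_ne_zero (hx.ne hij)
  have hy' : ∀ i j, i ≠ j → bracket (y i).rep (y j).rep ≠ 0 := fun i j hij =>
    bracket_rep_ne_zero (hy.ne hij)
  set a := fun i => (x i).rep with ha
  set b := fun i => (y i).rep with hb
  have a21 : bracket (a 2) (a 1) ≠ 0 := hx' 2 1 (by decide)
  have a02 : bracket (a 0) (a 2) ≠ 0 := hx' 0 2 (by decide)
  have a01 : bracket (a 0) (a 1) ≠ 0 := hx' 0 1 (by decide)
  have b21 : bracket (b 2) (b 1) ≠ 0 := hy' 2 1 (by decide)
  have b02 : bracket (b 0) (b 2) ≠ 0 := hy' 0 2 (by decide)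
  have b01 : bracket (b 0) (b 1) ≠ 0 := hy' 0 1 (by decide)
  obtain ⟨α, hα⟩ : ∃ α, α * bracket (a 2) (a 1) = bracket (b 2) (b 1) :=
    ⟨_, div_mul_cancel₀ _ a21⟩
  obtain ⟨β, hβ⟩ : ∃ β, β * bracket (a 0) (a 2) = bracket (b 0) (b 2) :=
    ⟨_, div_mul_cancel₀ _ a02⟩
  have hα0 : α ≠ 0 := by rintro rfl; exact b21 (by rw [← hα, zero_mul])
  have hβ0 : β ≠ 0 := by rintro rfl; exact b02 (by rw [← hβ, zero_mul])
  -- The map v ↦ α[v, a₁] b₀ + β[a₀, v] b₁ sends a₀, a₁ to multiples of b₀, b₁. By Cramer's rule, α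
  -- and β are what is needed for a₂ to go to [b₀, b₁] b₂.
  let M : Matrix (Fin 2) (Fin 2) ℂ :=
    !![α * a 1 1 * b 0 0 - β * a 0 1 * b 1 0, β * a 0 0 * b 1 0 - α * a 1 0 * b 0 0;
       α * a 1 1 * b 0 1 - β * a 0 1 * b 1 1, β * a 0 0 * b 1 1 - α * a 1 0 * b 0 1]
  have hM : ∀ v, M.mulVec v = (α * bracket v (a 1)) • b 0 + (β * bracket (a 0) v) • b 1 := by
    intro v
    ext i
    fin_cases i <;>
      simp [M, Matrix.mulVec, dotProduct, Fin.sum_univ_two, bracket] <;> ring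
  have hdet : M.det ≠ 0 := by
    have : M.det = α * β * bracket (a 0) (a 1) * bracket (b 0) (b 1) := by
      simp only [M, Matrix.det_fin_two_of, bracket]
      ring
    rw [this]
    exact mul_ne_zero (mul_ne_zero (mul_ne_zero hα0 hβ0) a01) b01
  let g : GL (Fin 2) ℂ := Matrix.GeneralLinearGroup.mkOfDetNeZero M hdet
  refine ⟨g, fun i => ?_⟩
  have key : bracket (M.mulVec (a i)) (b i) = 0 := by
    rw [hM]
    fin_cases i
    · simp only [bracket, Fin.zero_eta, Pi.add_apply, Pi.smul_apply, smul_eq_mul]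
      ring
    · simp only [bracket, Fin.mk_one, Pi.add_apply, Pi.smul_apply, smul_eq_mul]
      ring
    · change bracket ((α * bracket (a 2) (a 1)) • b 0 + (β * bracket (a 0) (a 2)) • b 1) (b 2) = 0
      rw [hα, hβ]
      simp only [bracket, Pi.add_apply, Pi.smul_apply, smul_eq_mul]
      ring
  rw [← (x i).mk_rep, Projectivization.smul_mk, ← (y i).mk_rep, ← bracket_eq_zero_iff]
  exact key

/-- Four distinct points can be moved to any four with the same cross-ratio. -/
theorem exists_smul_eq_of_pointCrossRatio_eq {x y : Fin 4 → P1} (hx : Function.Injective x)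
    (hy : Function.Injective y) (h : pointCrossRatio x = pointCrossRatio y) :
    ∃ g : GL (Fin 2) ℂ, ∀ i, g • x i = y i := by
  obtain ⟨g, hg⟩ := exists_smul_eq_of_three (x := fun i => x i.castSucc)
    (y := fun i => y i.castSucc) (hx.comp (Fin.castSucc_injective 3))
    (hy.comp (Fin.castSucc_injective 3))
  refine ⟨g, fun i => ?_⟩
  have h3 := eq_of_pointCrossRatio_eq (x := fun i => g • x i)
    ((MulAction.injective g).comp hx) hy (hg 0) (hg 1) (hg 2)
    (by rw [pointCrossRatio_smul, h])
  refine Fin.lastCases h3 (fun j => hg j) i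

/-- A Möbius transformation that fixes three points is the identity. -/
theorem smul_eq_self_of_three {g : GL (Fin 2) ℂ} {x : Fin 3 → P1} (hx : Function.Injective x)
    (h : ∀ i, g • x i = x i) (u : P1) : g • u = u := by
  by_cases hu : ∃ i, u = x i
  · obtain ⟨i, rfl⟩ := hu
    exact h i
  push Not at hu
  let z : Fin 4 → P1 := Fin.snoc (α := fun _ => P1) x u
  have hz : Function.Injective z := by
    rw [Fin.snoc_injective_iff]
    exact ⟨hx, fun ⟨i, hi⟩ => hu i hi.symm⟩
  have hz' : ∀ i : Fin 3, z i.castSucc = x i := fun i => Fin.snoc_castSucc (α := fun _ => P1) _ _ _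
  have hzl : z 3 = u := Fin.snoc_last (α := fun _ => P1) _ _
  have := eq_of_pointCrossRatio_eq (x := fun i => g • z i) (y := z)
    ((MulAction.injective g).comp hz) hz
    (by change g • z (Fin.castSucc 0) = z (Fin.castSucc 0); rw [hz', h])
    (by change g • z (Fin.castSucc 1) = z (Fin.castSucc 1); rw [hz', h])
    (by change g • z (Fin.castSucc 2) = z (Fin.castSucc 2); rw [hz', h])
    (pointCrossRatio_smul g z)
  simpa only [hzl] using this

theorem smul_eq_smul_of_three {g g' : GL (Fin 2) ℂ} {x : Fin 3 → P1} (hx : Function.Injective x)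
    (h : ∀ i, g • x i = g' • x i) (u : P1) : g • u = g' • u := by
  have := smul_eq_self_of_three (g := g'⁻¹ * g) hx (fun i => by
    rw [mul_smul, h, inv_smul_smul]) u
  rwa [mul_smul, inv_smul_eq_iff] at this

end
end CrossRatio

namespace CrossRatio
noncomputable section
open MvPolynomial

/-! ### The open set of admissible point configurations -/

section Homogenization

variable {S ι : Type*} [Fintype ι]

/-- The numerator of `G (N / D)`. -/
def fractionNumerator (N D : ι → MvPolynomial (S × Fin 2) ℂ) (G : MvPolynomial ι ℂ) :
    MvPolynomial (S × Fin 2) ℂ :=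
  ∑ m ∈ G.support, C (coeff m G) * ∏ e, N e ^ m e * D e ^ (degreeOf e G - m e)

/-- Powers of `D e` fill each monomial up to the full degree of `G` in the variable `e`, so all
terms have the same multidegree. -/
theorem isMultihomogeneous_fractionNumerator {N D : ι → MvPolynomial (S × Fin 2) ℂ}
    {d : ι → S →₀ ℕ} (hN : ∀ e, IsMultihomogeneous (N e) (d e))
    (hD : ∀ e, IsMultihomogeneous (D e) (d e)) (G : MvPolynomial ι ℂ) :
    IsMultihomogeneous (fractionNumerator N D G) (∑ e, degreeOf e G • d e) := by
  refine IsWeightedHomogeneous.sum _ _ _ fun m hm => IsWeightedHomogeneous.C_mul ?_ _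
  refine IsWeightedHomogeneous.prod _ _ _ fun e _ => ?_
  have h := (IsWeightedHomogeneous.pow (hN e) (m e)).mul
    (IsWeightedHomogeneous.pow (hD e) (degreeOf e G - m e))
  rwa [← add_smul, Nat.add_sub_cancel' (monomial_le_degreeOf e hm)] at h

theorem eval_fractionNumerator {N D : ι → MvPolynomial (S × Fin 2) ℂ} (G : MvPolynomial ι ℂ)
    {w : S × Fin 2 → ℂ} (hD : ∀ e, eval w (D e) ≠ 0) :
    eval w (fractionNumerator N D G) =
      (∏ e, eval w (D e) ^ degreeOf e G) * eval (fun e => eval w (N e) / eval w (D e)) G := by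
  rw [fractionNumerator, map_sum, eval_eq', Finset.mul_sum]
  refine Finset.sum_congr rfl fun m hm => ?_
  rw [map_mul, eval_C, map_prod, mul_left_comm, ← Finset.prod_mul_distrib]
  congr 1
  refine Finset.prod_congr rfl fun e _ => ?_
  rw [map_mul, map_pow, map_pow, div_pow]
  conv_rhs => rw [← Nat.add_sub_cancel' (monomial_le_degreeOf e hm), pow_add]
  have := pow_ne_zero (m e) (hD e)
  field_simp

end Homogenization

variable {n : ℕ} {T : Fin (n - 3) → (Fin 4 ↪ Fin n)}

/-- The index of the pair `(v, e)` where `v` is the `i`-th vertex of `e`. -/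
def edgeIndex (T : Fin (n - 3) → (Fin 4 ↪ Fin n)) (e : Fin (n - 3)) (i : Fin 4) : Incidence T :=
  ⟨T e i, e, i, rfl⟩

/-- The `i`-th of the four points of `ℙ¹` that `P` attaches to the hyperedge `e`. -/
def edgePoint (P : P1Pow (Incidence T)) (e : Fin (n - 3)) (i : Fin 4) : P1 := P (edgeIndex T e i)

/-- The cross-ratios of the quadruples of points attached to the hyperedges. -/
def edgeValue (P : P1Pow (Incidence T)) (e : Fin (n - 3)) : ℂ := pointCrossRatio (edgePoint P e)

/-- The configurations with distinct points on every hyperedge and with cross-ratios outside the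
zero locus of `G`. -/
def admissible (T : Fin (n - 3) → (Fin 4 ↪ Fin n)) (G : MvPolynomial (Fin (n - 3)) ℂ) :
    Set (P1Pow (Incidence T)) :=
  {P | (∀ e, Function.Injective (edgePoint P e)) ∧ eval (edgeValue P) G ≠ 0}

theorem evalAt_bracketForm_one {S : Type*} (P : P1Pow S) (s s' : S) :
    P.evalAt (bracketForm s s' 1) = bracket (P s).rep (P s').rep := by
  rw [P1Pow.evalAt, eval_bracketForm, Matrix.one_mulVec]
  rfl

theorem isOpen_ne {S : Type*} (s s' : S) : IsOpen {P : P1Pow S | P s ≠ P s'} := by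
  refine (congrArg IsOpen (Set.ext fun P => ?_)).mpr
    (isOpen_evalAt_ne_zero (isMultihomogeneous_bracketForm s s' 1))
  change P s ≠ P s' ↔ P.evalAt _ ≠ 0
  rw [evalAt_bracketForm_one, Ne, Ne, bracket_rep_eq_zero_iff]

theorem isOpen_injective_edgePoint (T : Fin (n - 3) → (Fin 4 ↪ Fin n)) :
    IsOpen {P : P1Pow (Incidence T) | ∀ e, Function.Injective (edgePoint P e)} := by
  have h : IsOpen (⋂ (e : Fin (n - 3)) (i : Fin 4) (j : Fin 4) (_ : i ≠ j),
      {P : P1Pow (Incidence T) | P (edgeIndex T e i) ≠ P (edgeIndex T e j)}) :=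
    isOpen_iInter_of_finite fun e => isOpen_iInter_of_finite fun i =>
      isOpen_iInter_of_finite fun j => isOpen_iInter_of_finite fun _ => isOpen_ne _ _
  refine (congrArg IsOpen (Set.ext fun P => ?_)).mpr h
  simp only [Set.mem_iInter]
  constructor
  · intro hP e i j hij
    exact (hP e).ne hij
  · intro hP e i j hij
    by_contra hne
    exact hP e i j hne hij

/-- Where the four points on each hyperedge are distinct, the denominators of the cross-ratios do
not vanish, and clearing them turns the condition into the nonvanishing of a multihomogeneous form.
-/
theorem isOpen_admissible (T : Fin (n - 3) → (Fin 4 ↪ Fin n)) (G : MvPolynomial (Fin (n - 3)) ℂ) :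
    IsOpen (admissible T G) := by
  let b : Fin (n - 3) → Fin 4 → Fin 4 → MvPolynomial (Incidence T × Fin 2) ℂ :=
    fun e i j => bracketForm (edgeIndex T e i) (edgeIndex T e j) 1
  let N := fun e => b e 2 0 * b e 3 1
  let D := fun e => b e 2 1 * b e 3 0
  let s : Fin (n - 3) → Fin 4 → (Incidence T →₀ ℕ) := fun e i => Finsupp.single (edgeIndex T e i) 1
  let d : Fin (n - 3) → (Incidence T →₀ ℕ) := fun e => s e 2 + s e 0 + (s e 3 + s e 1)
  have hb : ∀ e i j, IsMultihomogeneous (b e i j) (s e i + s e j) := fun e i j =>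
    isMultihomogeneous_bracketForm _ _ _
  have hN : ∀ e, IsMultihomogeneous (N e) (d e) := fun e => (hb e 2 0).mul (hb e 3 1)
  have hD : ∀ e, IsMultihomogeneous (D e) (d e) := fun e => by
    have h := (hb e 2 1).mul (hb e 3 0)
    rwa [show s e 2 + s e 1 + (s e 3 + s e 0) = d e by simp only [d]; abel] at h
  have hbe : ∀ (P : P1Pow (Incidence T)) e i j,
      eval P.coords (b e i j) = bracket (edgePoint P e i).rep (edgePoint P e j).rep :=
    fun P e i j => evalAt_bracketForm_one P _ _
  have hopen := (isOpen_injective_edgePoint T).inter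
    (isOpen_evalAt_ne_zero (isMultihomogeneous_fractionNumerator hN hD G))
  refine (congrArg IsOpen (Set.ext fun P => ?_)).mpr hopen
  change (_ ∧ _) ↔ (∀ e, Function.Injective (edgePoint P e)) ∧
    eval P.coords (fractionNumerator N D G) ≠ 0
  refine and_congr_right fun hP => ?_
  have hDe : ∀ e, eval P.coords (D e) ≠ 0 := fun e => by
    rw [map_mul, hbe, hbe]
    exact mul_ne_zero (bracket_rep_ne_zero ((hP e).ne (by decide)))
      (bracket_rep_ne_zero ((hP e).ne (by decide)))
  have hval : (fun e => eval P.coords (N e) / eval P.coords (D e)) = edgeValue P := by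
    funext e
    simp only [N, D, map_mul, hbe]
    rfl
  rw [eval_fractionNumerator G hDe, hval, Ne, Ne, mul_eq_zero, or_iff_right]
  exact Finset.prod_ne_zero_iff.mpr fun e _ => pow_ne_zero _ (hDe e)

/-- Homogeneous coordinates of the points `0, ∞, c, 1`, whose cross-ratio is `c`. -/
def standardVector (c : ℂ) : Fin 4 → Fin 2 → ℂ := ![![0, 1], ![1, 0], ![c, 1], ![1, 1]]

theorem standardVector_ne_zero (c : ℂ) (i : Fin 4) : standardVector c i ≠ 0 := by
  intro h
  have h0 := congrFun h 0
  have h1 := congrFun h 1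
  fin_cases i <;> simp [standardVector] at h0 h1

theorem exists_quadruple {c : ℂ} (h0 : c ≠ 0) (h1 : c ≠ 1) :
    ∃ x : Fin 4 → P1, Function.Injective x ∧ pointCrossRatio x = c := by
  refine ⟨fun i => Projectivization.mk ℂ (standardVector c i) (standardVector_ne_zero c i), ?_, ?_⟩
  · intro i j hij
    rw [← bracket_eq_zero_iff] at hij
    have h2 : c - 1 ≠ 0 := sub_ne_zero.mpr h1
    have h3 : 1 - c ≠ 0 := sub_ne_zero.mpr h1.symm
    fin_cases i <;> fin_cases j <;>
      first | rfl | (exfalso; simp [standardVector, bracket, h0, h2, h3] at hij)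
  · rw [pointCrossRatio_mk]
    simp [standardVector, crossRatio, bracket]

theorem admissible_nonempty (T : Fin (n - 3) → (Fin 4 ↪ Fin n)) {G : MvPolynomial (Fin (n - 3)) ℂ}
    (hG : G ≠ 0) : (admissible T G).Nonempty := by
  -- The extra factors keep the cross-ratios away from 0 and 1, so that distinct points realise
  -- them.
  have hne : G * ∏ e, (X e * (X e - 1) : MvPolynomial (Fin (n - 3)) ℂ) ≠ 0 := by
    refine mul_ne_zero hG (Finset.prod_ne_zero_iff.mpr fun e _ => mul_ne_zero (X_ne_zero e) ?_)
    intro h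
    have := congrArg (eval (0 : Fin (n - 3) → ℂ)) h
    simp at this
  obtain ⟨c, hc⟩ := exists_eval_ne_zero hne
  rw [map_mul, map_prod] at hc
  have hc' : ∀ e, c e ≠ 0 ∧ c e ≠ 1 := fun e => by
    have h := Finset.prod_ne_zero_iff.mp (right_ne_zero_of_mul hc) e (Finset.mem_univ e)
    simp only [map_mul, map_sub, eval_X, map_one] at h
    exact ⟨left_ne_zero_of_mul h, sub_ne_zero.mp (right_ne_zero_of_mul h)⟩
  choose x hx hxc using fun e => exists_quadruple (hc' e).1 (hc' e).2
  -- Each incidence belongs to a single hyperedge, so the quadruples can be chosen independently;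
  -- `choose` recovers the position of the vertex in it.
  let P : P1Pow (Incidence T) := fun p => x p.2.1 p.2.2.choose
  have hP : edgePoint P = x := by
    funext e i
    have h : (edgeIndex T e i).2.2.choose = i :=
      (T e).injective (edgeIndex T e i).2.2.choose_spec
    exact congrArg (x e) h
  have hv : edgeValue P = c := by
    funext e
    rw [edgeValue, hP, hxc]
  refine ⟨P, ?_, ?_⟩
  · intro e
    rw [hP]
    exact hx e
  · rw [hv]
    exact left_ne_zero_of_mul hc

end
end CrossRatio

namespace CrossRatio
noncomputable section
open MvPolynomial
open scoped MatrixGroups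

/-! ### Normalised configurations of marked points -/

/-- The marked points `∞, 0, 1, t₃, t₄, …` in homogeneous coordinates, as polynomials in `t`. -/
def markedPoly (n : ℕ) (v : Fin n) : Fin 2 → MvPolynomial {v : Fin n // 3 ≤ v.val} ℂ :=
  if h : 3 ≤ v.val then ![X ⟨v, h⟩, 1]
  else if v.val = 0 then ![1, 0]
  else if v.val = 1 then ![0, 1]
  else ![1, 1]

variable {n : ℕ}

theorem algebraMap_markedPoly (v : Fin n) (i : Fin 2) :
    algebraMap _ (M0FunctionField n) (markedPoly n v i) = genericMarkedPoint n v i := by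
  unfold markedPoly genericMarkedPoint
  split_ifs <;> fin_cases i <;> simp

/-- The marked points with parameters `t`, in homogeneous coordinates. -/
def markedVector (t : {v : Fin n // 3 ≤ v.val} → ℂ) (v : Fin n) : Fin 2 → ℂ :=
  fun i => eval t (markedPoly n v i)

theorem markedVector_of_le (t : {v : Fin n // 3 ≤ v.val} → ℂ) {v : Fin n} (hv : 3 ≤ v.val) :
    markedVector t v = ![t ⟨v, hv⟩, 1] := by
  ext i
  simp only [markedVector, markedPoly, dif_pos hv]
  fin_cases i <;> simp

theorem markedVector_ne_zero (t : {v : Fin n // 3 ≤ v.val} → ℂ) (v : Fin n) :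
    markedVector t v ≠ 0 := by
  intro h
  have h0 := congrFun h 0
  have h1 := congrFun h 1
  unfold markedVector markedPoly at h0 h1
  split_ifs at h0 h1 <;> simp at h0 h1

/-- The configuration `∞, 0, 1, t₃, t₄, …`. -/
def markedPoint (t : {v : Fin n // 3 ≤ v.val} → ℂ) (v : Fin n) : P1 :=
  Projectivization.mk ℂ (markedVector t v) (markedVector_ne_zero t v)

theorem markedPoint_of_le (t : {v : Fin n // 3 ≤ v.val} → ℂ) {v : Fin n} (hv : 3 ≤ v.val) :
    markedPoint t v = affinePoint (t ⟨v, hv⟩) := by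
  simp only [markedPoint, affinePoint, markedVector_of_le t hv]

/-- The points `∞, 0, 1`. -/
def basePoint : Fin 3 → P1 := ![infinityPoint, affinePoint 0, affinePoint 1]

theorem basePoint_injective : Function.Injective basePoint := by
  have h1 := affinePoint_ne_infinityPoint 0
  have h2 := affinePoint_ne_infinityPoint 1
  have h3 : affinePoint 0 ≠ affinePoint 1 := affinePoint_injective.ne zero_ne_one
  intro i j hij
  fin_cases i <;> fin_cases j <;>
    first | rfl | (exfalso; simp [basePoint, h1, h2, h3, h1.symm, h2.symm, h3.symm] at hij)

theorem markedPoint_castLE (hn : 3 ≤ n) (t : {v : Fin n // 3 ≤ v.val} → ℂ) (i : Fin 3) :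
    markedPoint t (Fin.castLE hn i) = basePoint i := by
  have h : markedVector t (Fin.castLE hn i) = (![![1, 0], ![0, 1], ![1, 1]] : Fin 3 → _) i := by
    ext j
    fin_cases i <;> fin_cases j <;> simp [markedVector, markedPoly]
  simp only [markedPoint, h]
  fin_cases i <;> rfl

/-- Every configuration of distinct points has a normal form. -/
theorem exists_smul_eq_markedPoint (hn : 3 ≤ n) {z : Fin n → P1} (hz : Function.Injective z) :
    ∃ (g : GL (Fin 2) ℂ) (t : {v : Fin n // 3 ≤ v.val} → ℂ), ∀ v, g • z v = markedPoint t v := by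
  obtain ⟨g, hg⟩ := exists_smul_eq_of_three (x := fun i => z (Fin.castLE hn i))
    (hz.comp (Fin.castLE_injective hn)) basePoint_injective
  refine ⟨g, fun v => affineCoord (g • z v), fun v => ?_⟩
  by_cases hv : 3 ≤ v.val
  -- ∞ is already the image of the point numbered 0, so this point has a genuine affine coordinate.
  · rw [markedPoint_of_le _ hv, affinePoint_affineCoord]
    change _ ≠ basePoint 0
    rw [← hg 0]
    refine (MulAction.injective g).ne (hz.ne fun h => ?_)
    rw [show v = Fin.castLE hn 0 from h] at hv
    simp at hv
  · have : v = Fin.castLE hn ⟨v.val, by omega⟩ := rfl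
    rw [this, markedPoint_castLE, hg]

/-- Configurations in normal form are determined up to equality by their Möbius class. -/
theorem eq_of_smul_markedPoint_eq (hn : 3 ≤ n) {t t' : {v : Fin n // 3 ≤ v.val} → ℂ}
    {g : GL (Fin 2) ℂ} (h : ∀ v, g • markedPoint t v = markedPoint t' v) : t = t' := by
  have hg := smul_eq_self_of_three (g := g) basePoint_injective fun i => by
    rw [← markedPoint_castLE hn t i, h, markedPoint_castLE, markedPoint_castLE]
  funext v
  have hv := h v
  rw [hg, markedPoint_of_le _ v.2, markedPoint_of_le _ v.2] at hv
  exact affinePoint_injective hv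

/-! ### The fibres of the cross-ratio map -/

/-- The bracket of two marked points. -/
def markedBracket (n : ℕ) (v w : Fin n) : MvPolynomial {v : Fin n // 3 ≤ v.val} ℂ :=
  markedPoly n v 0 * markedPoly n w 1 - markedPoly n v 1 * markedPoly n w 0

theorem eval_markedBracket (t : {v : Fin n // 3 ≤ v.val} → ℂ) (v w : Fin n) :
    eval t (markedBracket n v w) = bracket (markedVector t v) (markedVector t w) := by
  simp [markedBracket, bracket, markedVector]

theorem algebraMap_markedBracket (v w : Fin n) :
    algebraMap _ (M0FunctionField n) (markedBracket n v w) =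
      bracket (genericMarkedPoint n v) (genericMarkedPoint n w) := by
  simp only [markedBracket, bracket, map_sub, map_mul, algebraMap_markedPoly]

theorem eval_markedBracket_ne_zero_iff (t : {v : Fin n // 3 ≤ v.val} → ℂ) (v w : Fin n) :
    eval t (markedBracket n v w) ≠ 0 ↔ markedPoint t v ≠ markedPoint t w := by
  rw [eval_markedBracket, Ne, bracket_eq_zero_iff (markedVector_ne_zero t v)
    (markedVector_ne_zero t w)]
  rfl

theorem eval_prod_markedBracket_ne_zero_iff (t : {v : Fin n // 3 ≤ v.val} → ℂ) :
    eval t (∏ p ∈ Finset.univ.offDiag, markedBracket n p.1 p.2) ≠ 0 ↔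
      Function.Injective (markedPoint t) := by
  rw [map_prod, Finset.prod_ne_zero_iff]
  simp only [eval_markedBracket_ne_zero_iff, Finset.mem_offDiag, Finset.mem_univ, true_and,
    Prod.forall]
  exact ⟨fun h v w => not_imp_not.mp (h v w), fun h v w => h.ne⟩

theorem natCard_parameters (n : ℕ) : Nat.card {v : Fin n // 3 ≤ v.val} = n - 3 := by
  rw [Nat.card_congr (β := Fin (n - 3))
    { toFun := fun v => ⟨v.1.val - 3, by omega⟩
      invFun := fun i => ⟨⟨i.val + 3, by omega⟩, by simp⟩
      left_inv := fun v => Subtype.ext (Fin.ext (Nat.sub_add_cancel v.2))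
      right_inv := fun i => Fin.ext (Nat.add_sub_cancel i.val 3) }, Nat.card_fin]

/-- The number of points of a general fibre of `CR_𝒯`. -/
theorem exists_encard_fibre_crossRatio (hn : 4 ≤ n) (T : Fin (n - 3) → (Fin 4 ↪ Fin n)) :
    ∃ g : MvPolynomial (Fin (n - 3)) ℂ, g ≠ 0 ∧ ∀ lam, eval lam g ≠ 0 →
      {t : {v : Fin n // 3 ≤ v.val} → ℂ | Function.Injective (markedPoint t) ∧
        ∀ e, pointCrossRatio (fun i => markedPoint t (T e i)) = lam e}.encard =
      crossRatioDegree T := by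
  have hh : (∏ p ∈ Finset.univ.offDiag, markedBracket n p.1 p.2) ≠ 0 := by
    let z : Fin n → P1 := fun v => Infinite.natEmbedding P1 v
    have hz : Function.Injective z :=
      (Infinite.natEmbedding P1).injective.comp Fin.val_injective
    obtain ⟨g, t, ht⟩ := exists_smul_eq_markedPoint (by omega) hz
    have hinj : Function.Injective (markedPoint t) := by
      rw [show markedPoint t = (g • ·) ∘ z from funext fun v => (ht v).symm]
      exact (MulAction.injective g).comp hz
    intro h0
    apply (eval_prod_markedBracket_ne_zero_iff t).mpr hinj
    rw [h0, map_zero]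
  let N := fun e => markedBracket n (T e 2) (T e 0) * markedBracket n (T e 3) (T e 1)
  let D := fun e => markedBracket n (T e 2) (T e 1) * markedBracket n (T e 3) (T e 0)
  have hD : ∀ t, Function.Injective (markedPoint t) → ∀ e, eval t (D e) ≠ 0 := by
    intro t ht e
    rw [map_mul]
    refine mul_ne_zero ?_ ?_ <;> rw [eval_markedBracket_ne_zero_iff] <;>
      exact ht.ne ((T e).injective.ne (by decide))
  obtain ⟨g, hg, hgen⟩ := exists_encard_fibre_eq (K := M0FunctionField n)
    (by rw [natCard_parameters, Nat.card_fin]) N D hh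
    (fun t ht => hD t ((eval_prod_markedBracket_ne_zero_iff t).mp ht)) (f := crossRatioMap T)
    (fun e => by
      simp only [N, D, map_mul, algebraMap_markedBracket]
      rfl)
  refine ⟨g, hg, fun lam hlam => ?_⟩
  have h := hgen lam hlam
  rw [crossRatioDegree, ← h]
  congr 1
  ext t
  change (_ ∧ _) ↔ (_ ∧ _)
  rw [eval_prod_markedBracket_ne_zero_iff]
  refine and_congr_right fun ht => forall_congr' fun e => ?_
  rw [← div_eq_iff (hD t ht e)]
  simp only [N, D, map_mul, eval_markedBracket]
  rw [← crossRatio]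
  refine Eq.congr_left ?_
  exact pointCrossRatio_mk fun i => markedVector_ne_zero t (T e i)

/-- If the cross-ratios of a configuration are general then its points are distinct and every
vertex lies on a hyperedge. -/
theorem exists_nondegeneracy_condition (hn : 4 ≤ n) (T : Fin (n - 3) → (Fin 4 ↪ Fin n)) :
    ∃ R : MvPolynomial (Fin (n - 3)) ℂ, R ≠ 0 ∧ ∀ z : Fin n → P1,
      (∀ e, Function.Injective fun i => z (T e i)) →
      eval (fun e => pointCrossRatio fun i => z (T e i)) R ≠ 0 →
      Function.Injective z ∧ ∀ v, (edgesAt T v).Nonempty := by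
  classical
  choose R hR0 hR using fun ρ : {ρ : Fin n → Fin n // ¬ Function.Surjective ρ} =>
    exists_relation_of_not_surjective hn T ρ.1 ρ.2
  refine ⟨∏ ρ, R ρ, Finset.prod_ne_zero_iff.mpr fun ρ _ => hR0 ρ, fun z hz hzR => ?_⟩
  rw [map_prod, Finset.prod_ne_zero_iff] at hzR
  -- Replacing b by a leaves a non-surjective relabelling. If it does not affect the points on
  -- hyperedges, the cross-ratios satisfy the corresponding relation. Both a coincidence z a = z b
  -- and a vertex b on no hyperedge give this situation.
  have key : ∀ a b, a ≠ b →
      ¬ ∀ e i, z (Function.update id b a (T e i)) = z (T e i) := by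
    intro a b hab h
    have hρ : ¬ Function.Surjective (Function.update id b a) := by
      intro hs
      obtain ⟨c, hc⟩ := hs b
      by_cases hcb : c = b
      · rw [hcb, Function.update_self] at hc
        exact hab hc
      · rw [Function.update_of_ne hcb] at hc
        exact hcb hc
    refine hzR ⟨_, hρ⟩ (Finset.mem_univ _) ?_
    have h1 := hR ⟨_, hρ⟩ (fun v => (z v).rep) fun e i j hij => by
      dsimp only
      rw [h, h]
      exact bracket_rep_ne_zero ((hz e).ne hij)
    rw [← h1]
    congr 2
    funext e
    simp only [edgeCrossRatio, pointCrossRatio, Function.comp_apply, h]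
  constructor
  · intro a b hab
    by_contra hne
    refine key a b hne fun e i => ?_
    by_cases hb : T e i = b
    · rw [hb, Function.update_self, hab]
    · rw [Function.update_of_ne hb, id]
  · intro v
    by_contra hv
    have : Nontrivial (Fin n) := Fin.nontrivial_iff_two_le.mpr (by omega)
    obtain ⟨a, ha⟩ := exists_ne v
    refine key a v ha fun e i => ?_
    rw [Function.update_of_ne, id]
    intro h
    exact hv ⟨e, i, h⟩

/-! ### Curves through the linear subvarieties -/

variable {T : Fin (n - 3) → (Fin 4 ↪ Fin n)}

theorem moebiusCurve_inter_linearSubvariety_nonempty_iff (A : Fin (n - 3) → GL (Fin 2) ℂ)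
    (P : P1Pow (Incidence T)) (v : Fin n) :
    (moebiusCurve A ∩ linearSubvariety (edgesAt T v) (component P v)).Nonempty ↔
      ∃ u : P1, ∀ e i, T e i = v → A e • u = edgePoint P e i := by
  constructor
  · rintro ⟨_, ⟨u, rfl⟩, hu⟩
    refine ⟨u, ?_⟩
    rintro e i rfl
    exact congrFun hu ⟨e, i, rfl⟩
  · rintro ⟨u, hu⟩
    refine ⟨moebiusMap A u, ⟨u, rfl⟩, ?_⟩
    funext ⟨e, i, hi⟩
    subst hi
    exact hu e i rfl

/-- The curves through all the linear subvarieties correspond to the normalised configurations with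
the prescribed cross-ratios. -/
theorem encard_curves_eq_encard_configurations (hn : 4 ≤ n) {P : P1Pow (Incidence T)}
    (hP : ∀ e, Function.Injective (edgePoint P e))
    (hgen : ∀ z : Fin n → P1, (∀ e, Function.Injective fun i => z (T e i)) →
      (fun e => pointCrossRatio fun i => z (T e i)) = edgeValue P →
      Function.Injective z ∧ ∀ v, (edgesAt T v).Nonempty) :
    {C ∈ curveModuli (Fin (n - 3)) | ∀ v : Fin n,
      (C ∩ linearSubvariety (edgesAt T v) (component P v)).Nonempty}.encard =
    {t : {v : Fin n // 3 ≤ v.val} → ℂ | Function.Injective (markedPoint t) ∧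
      ∀ e, pointCrossRatio (fun i => markedPoint t (T e i)) = edgeValue P e}.encard := by
  set F := {t : {v : Fin n // 3 ≤ v.val} → ℂ | Function.Injective (markedPoint t) ∧
      ∀ e, pointCrossRatio (fun i => markedPoint t (T e i)) = edgeValue P e} with hF
  have : NeZero (n - 3) := ⟨by omega⟩
  have hn3 : 3 ≤ n := by omega
  have hA : ∀ t, ∃ A : Fin (n - 3) → GL (Fin 2) ℂ, t ∈ F →
      ∀ e i, A e • markedPoint t (T e i) = edgePoint P e i := by
    intro t
    by_cases ht : t ∈ F
    · choose A hA using fun e => exists_smul_eq_of_pointCrossRatio_eq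
        (ht.1.comp (T e).injective) (hP e) (ht.2 e)
      exact ⟨A, fun _ => hA⟩
    · exact ⟨1, fun h => absurd h ht⟩
  choose A hA using hA
  -- A point of a Möbius curve is determined by any one coordinate. As each vertex lies on a
  -- hyperedge, the curve meets Y_v only once, so its points over the vertices recover the
  -- configuration up to a Möbius transformation.
  have hinj : Set.InjOn (fun t => moebiusCurve (A t)) F := by
    intro t ht t' ht' h
    have hE := (hgen (markedPoint t) (fun e => ht.1.comp (T e).injective) (funext ht.2)).2
    have hmap : ∀ v, moebiusMap (A t) (markedPoint t v) = moebiusMap (A t') (markedPoint t' v) := by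
      intro v
      have hmem : moebiusMap (A t) (markedPoint t v) ∈ moebiusCurve (A t') := by
        rw [← show moebiusCurve (A t) = moebiusCurve (A t') from h]
        exact ⟨_, rfl⟩
      obtain ⟨u, hu⟩ := hmem
      obtain ⟨e, i, rfl⟩ := hE v
      have h1 : A t' e • u = A t e • markedPoint t (T e i) := congrFun hu e
      rw [hA t ht, ← hA t' ht'] at h1
      rw [← hu, MulAction.injective (A t' e) h1]
    refine eq_of_smul_markedPoint_eq hn3 (g := (A t' 0)⁻¹ * A t 0) fun v => ?_
    rw [mul_smul, inv_smul_eq_iff]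
    exact congrFun (hmap v) 0
  rw [← hinj.encard_image]
  congr 1
  ext C
  constructor
  · rintro ⟨hC, hCv⟩
    obtain ⟨B, rfl⟩ := exists_eq_moebiusCurve hC
    -- The parameters at which the curve meets the Y_v form the configuration sought; `B e` carries
    -- its cross-ratio on e to that of P.
    choose u hu using fun v => (moebiusCurve_inter_linearSubvariety_nonempty_iff B P v).mp (hCv v)
    have hedge : ∀ e i, B e • u (T e i) = edgePoint P e i := fun e i => hu _ e i rfl
    have huinj : ∀ e, Function.Injective fun i => u (T e i) := fun e i j hij => hP e (by
      rw [← hedge, ← hedge, show u (T e i) = u (T e j) from hij])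
    have hucr : ∀ e, (pointCrossRatio fun i => u (T e i)) = edgeValue P e := fun e => by
      rw [← pointCrossRatio_smul (B e), edgeValue]
      exact congrArg pointCrossRatio (funext (hedge e))
    obtain ⟨g, t, ht⟩ := exists_smul_eq_markedPoint hn3 (hgen u huinj (funext hucr)).1
    have hmp : markedPoint t = fun v => g • u v := funext fun v => (ht v).symm
    have htF : t ∈ F := by
      refine ⟨?_, fun e => ?_⟩
      · rw [hmp]
        exact (MulAction.injective g).comp (hgen u huinj (funext hucr)).1
      · rw [hmp, pointCrossRatio_smul g, hucr]
    refine ⟨t, htF, ?_⟩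
    change moebiusCurve (A t) = moebiusCurve B
    rw [← moebiusCurve_mul_right (A t) g]
    -- Both transformations agree on three distinct points of each hyperedge.
    have hmap : moebiusMap (fun e => A t e * g) = moebiusMap B := by
      funext w e
      refine smul_eq_smul_of_three (g := A t e * g) (g' := B e)
        (x := fun i => u (T e (Fin.castSucc i)))
        ((huinj e).comp (Fin.castSucc_injective 3)) (fun i => ?_) w
      rw [mul_smul, ht, hA t htF, hedge]
    rw [moebiusCurve, hmap, moebiusCurve]
  · rintro ⟨t, ht, rfl⟩
    refine ⟨moebiusCurve_mem_curveModuli _, fun v => ?_⟩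
    refine (moebiusCurve_inter_linearSubvariety_nonempty_iff _ P v).mpr ⟨markedPoint t v, ?_⟩
    rintro e i rfl
    exact hA t ht e i

end
end CrossRatio

theorem proposition2p1 (n : ℕ) (hn : 4 ≤ n) (T : Fin (n - 3) → (Fin 4 ↪ Fin n)) :
    ∃ U : Set (CrossRatio.P1Pow (CrossRatio.Incidence T)), IsOpen U ∧ U.Nonempty ∧
      ∀ P ∈ U,
        {C ∈ CrossRatio.curveModuli (Fin (n - 3)) |
            ∀ v : Fin n, (C ∩ CrossRatio.linearSubvariety (CrossRatio.edgesAt T v)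
              (CrossRatio.component P v)).Nonempty}.encard = CrossRatio.crossRatioDegree T ∧
        (⋂ v : Fin n, CrossRatio.incidenceSubvariety (CrossRatio.edgesAt T v)
            (CrossRatio.component P v)).encard = CrossRatio.crossRatioDegree T := by
  obtain ⟨g, hg, hfib⟩ := CrossRatio.exists_encard_fibre_crossRatio hn T
  obtain ⟨R, hR, hnd⟩ := CrossRatio.exists_nondegeneracy_condition hn T
  refine ⟨CrossRatio.admissible T (g * R), CrossRatio.isOpen_admissible T _,
    CrossRatio.admissible_nonempty T (mul_ne_zero hg hR), fun P hP => ?_⟩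
  have hval := hP.2
  rw [map_mul] at hval
  have hcount := (CrossRatio.encard_curves_eq_encard_configurations hn hP.1 fun z hz hcr =>
    hnd z hz (by rw [hcr]; exact right_ne_zero_of_mul hval)).trans
      (hfib _ (left_ne_zero_of_mul hval))
  refine ⟨hcount, Eq.trans (congrArg Set.encard (Set.ext fun C => ?_)) hcount⟩
  -- An index is needed for membership in the intersection to imply membership in the moduli space.
  have : NeZero n := ⟨by omega⟩
  rw [Set.mem_iInter]
  exact ⟨fun h => ⟨(h 0).1, fun v => (h v).2⟩, fun h v => ⟨h.1, h.2 v⟩⟩
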